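/- **Protocols.** Let $\mathcal A,\mathcal M,\mathcal B$ be finite-dimensional complex Hilbert spaces. For $n$ even, an $n$-message *weak coin flipping (WCF) protocol* consists of unit vectors $\psi_{A,0}\in\mathcal A$, $\psi_{M,0}\in\mathcal M$, $\psi_{B,0}\in\mathcal B$; unitaries $U_{A,i}$ and orthogonal projectors $E_{A,i}$ on $\mathcal A\otimes\mathcal M$ for odd $i\in\{1,\dots,n\}$; unitaries $U_{B,i}$ and orthogonal projectors $E_{B,i}$ on $\mathcal M\otimes\mathcal B$ for even $i\in\{1,\dots,n\}$; and two POVMs $\{\Pi_A^{(0)},\Pi_A^{(1)}\}$ on $\mathcal A$ and $\{\Pi_B^{(0)},\Pi_B^{(1)}\}$ on $\mathcal B$. Let $U_i=U_{A,i}\otimes I_{\mathcal B}$, $E_i=E_{A,i}\otimes I_{\mathcal B}$ for $i$ odd, $U_i=I_{\mathcal A}\otimes U_{B,i}$, $E_i=I_{\mathcal A}\otimes E_{B,i}$ for $i$ even, $\psi_0=\psi_{A,0}\otimes\psi_{M,0}\otimes\psi_{B,0}$ and $\psi_i=U_i\cdots U_1\psi_0$ (the honest states). It is required that $E_i\psi_i=\psi_i$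 for $1\le i\le n$, that $\Pi_A^{(0)}\otimes I\otimes\Pi_B^{(1)}\psi_n=\Pi_A^{(1)}\otimes I\otimes\Pi_B^{(0)}\psi_n=0$, and that $\|\Pi_A^{(0)}\otimes I\otimes\Pi_B^{(0)}\psi_n\|^2=\|\Pi_A^{(1)}\otimes I\otimes\Pi_B^{(1)}\psi_n\|^2=\tfrac12$. In odd rounds $i$ Alice applies $U_{A,i}$ and measures $\{E_{A,i},I-E_{A,i}\}$; in even rounds $i$ Bob applies $U_{B,i}$ and measures $\{E_{B,i},I-E_{B,i}\}$. On the second outcome the measuring player stops and declares himself or herself the winner. After round $n$ the players apply their POVMs; outcome $0$ means that Alice wins, outcome $1$ that Bob wins. **Cheating probabilities.** $P_B^*$ is the supremum, over all strategies of Bob, of the probability that honest Alice reaches the end and outputs $1$. In a strategy Bob has a workspace $\mathbb C^d$ of arbitrary finite dimension, initially in a unit vector of his choice (while $\mathcal A\otimes\mathcal M$ is initially in the state $\psi_{A,0}\otimes\psi_{M,0}$ prepared by Alice), and in every even round he applies an arbitrary unitary on $\mathcal M\otimes\mathbb C^d$. $\widehat P_B\ge P_B^*$ is the same supremum when Bob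 may moreover choose an arbitrary unit vector of $\mathcal M\otimes\mathbb C^d$ as initial state. $P_A^*$ is the supremum, over all strategies of Alice, of the probability that honest Bob reaches the end and outputs $0$; Alice has a workspace $\mathbb C^d$, chooses an arbitrary initial unit vector of $\mathbb C^d\otimes\mathcal M$ and applies in every odd round an arbitrary unitary on $\mathbb C^d\otimes\mathcal M$. **Dual feasible points.** Positive semidefinite matrices $Z_{A,0},\dots,Z_{A,n}$ on $\mathcal A$ form a *dual feasible point* with eigenvalue $\beta>0$ if $Z_{A,i-1}\otimes I_{\mathcal M}\succeq U_{A,i}^\dagger E_{A,i}(Z_{A,i}\otimes I_{\mathcal M})E_{A,i}U_{A,i}$ for $i$ odd, $Z_{A,i-1}=Z_{A,i}$ for $i$ even, $Z_{A,n}=\Pi_A^{(1)}$ and $Z_{A,0}\psi_{A,0}=\beta\psi_{A,0}$. Positive semidefinite matrices $Z_{B,0},\dots,Z_{B,n}$ on $\mathcal B$ form a *dual feasible point* with eigenvalue $\alpha>0$ if $I_{\mathcal M}\otimes Z_{B,i-1}\succeq U_{B,i}^\dagger E_{B,i}(I_{\mathcal M}\otimes Z_{B,i})E_{B,i}U_{B,i}$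 for $i$ even, $Z_{B,i-1}=Z_{B,i}$ for $i$ odd, $Z_{B,n}=\Pi_B^{(0)}$ and $Z_{B,0}\psi_{B,0}=\alpha\psi_{B,0}$. **Point games.** For a positive semidefinite matrix $Z$ let $\Pi_Z^{[z]}$ be the orthogonal projector onto its eigenspace for $z$ (zero if $z$ is not an eigenvalue). For $z,z_A,z_B\ge0$ put $\mathrm{prob}[Z,\psi](z)=\langle\psi|\Pi_Z^{[z]}|\psi\rangle$ and $\mathrm{prob}[Z_A,Z_B,\psi](z_A,z_B)=\langle\psi|\Pi_{Z_A}^{[z_A]}\otimes I_{\mathcal M}\otimes\Pi_{Z_B}^{[z_B]}|\psi\rangle$. A transition $l\to r$ of functions $[0,\infty)\to[0,\infty)$ with finite support is *EBM* if there are matrices $0\preceq X\preceq Y$ and a vector $\psi$ with $l=\mathrm{prob}[X,\psi]$ and $r=\mathrm{prob}[Y,\psi]$. A transition $p\to q$ of functions $[0,\infty)^2\to[0,\infty)$ with finite support is *EBM horizontal* if $p(\cdot,y)\to q(\cdot,y)$ is EBM for all $y\ge 0$, and *EBM vertical* if $p(x,\cdot)\to q(x,\cdot)$ is EBM for all $x\ge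 0$. Write $[x,y]$ for the function that is $1$ at $(x,y)$ and $0$ elsewhere. An *EBM point game with final point $[\beta,\alpha]$* is a sequence $p_0,\dots,p_m$ of functions $[0,\infty)^2\to[0,\infty)$ with finite support such that $p_0=\frac12[0,1]+\frac12[1,0]$, $p_m=[\beta,\alpha]$, and for $0\le i<m$ the transition $p_i\to p_{i+1}$ is EBM vertical if $i$ is even and EBM horizontal if $i$ is odd. **Proposition.** For every WCF protocol and every $\delta>0$: 1. There is an EBM point game with final point $[P_B^*+\delta,\,P_A^*+\delta]$. 2. There are dual feasible points $\{Z_{A,i}\}$ with eigenvalue $\beta=\widehat P_B+\delta$ and $\{Z_{B,i}\}$ with eigenvalue $\alpha=P_A^*+\delta$ such that the sequence $p_{n-i}=\mathrm{prob}[Z_{A,i},Z_{B,i},\psi_i]$, $0\le i\le n$, is an EBM point game with final point $[\beta,\alpha]$. -/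

import Mathlib

open scoped NNReal Kronecker Matrix ComplexOrder

namespace CoinFlip

noncomputable section

/-! ### Tensor products of three finite-dimensional spaces

A finite-dimensional Hilbert space with a fixed orthonormal basis is `ι → ℂ` for a finite type `ι`;
the space `𝒜 ⊗ ℳ ⊗ ℬ` is `A × M × B → ℂ`. -/

/-- `⟨v, w⟩`, conjugate-linear in the first argument. -/
def braket {ι : Type*} [Fintype ι] (v w : ι → ℂ) : ℂ := star v ⬝ᵥ w

/-- The squared Euclidean norm. -/
def sqNorm {ι : Type*} [Fintype ι] (v : ι → ℂ) : ℝ := ∑ i, ‖v i‖ ^ 2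

/-- The product vector `v ⊗ w`. -/
def tensorVec {ι κ : Type*} (v : ι → ℂ) (w : κ → ℂ) : ι × κ → ℂ := fun x => v x.1 * w x.2

/-- `X ⊗ 1_ℬ`, for `X` acting on `𝒜 ⊗ ℳ`. -/
def onAM {A M B : Type*} [DecidableEq B] (X : Matrix (A × M) (A × M) ℂ) :
    Matrix (A × M × B) (A × M × B) ℂ :=
  Matrix.reindex (Equiv.prodAssoc A M B) (Equiv.prodAssoc A M B) (X ⊗ₖ (1 : Matrix B B ℂ))

/-- `1_𝒜 ⊗ X`, for `X` acting on `ℳ ⊗ ℬ`. -/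
def onMB {A M B : Type*} [DecidableEq A] (X : Matrix (M × B) (M × B) ℂ) :
    Matrix (A × M × B) (A × M × B) ℂ :=
  (1 : Matrix A A ℂ) ⊗ₖ X

/-- `X ⊗ 1_ℳ ⊗ Y`, for `X` acting on `𝒜` and `Y` acting on `ℬ`. -/
def onAB {A M B : Type*} [DecidableEq M] (X : Matrix A A ℂ) (Y : Matrix B B ℂ) :
    Matrix (A × M × B) (A × M × B) ℂ :=
  X ⊗ₖ ((1 : Matrix M M ℂ) ⊗ₖ Y)

/-! ### Protocols -/

/-- The data of an `n`-message protocol on `𝒜 ⊗ ℳ ⊗ ℬ`. Rounds are numbered `1, …, n`. Only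
`UA i`, `EA i` with `i` odd and `UB i`, `EB i` with `i` even, `1 ≤ i ≤ n`, are used. -/
structure Protocol (A M B : Type*) where
  /-- number of messages -/
  n : ℕ
  /-- initial state of Alice's workspace -/
  ψA : A → ℂ
  /-- initial state of the message space -/
  ψM : M → ℂ
  /-- initial state of Bob's workspace -/
  ψB : B → ℂ
  /-- Alice's unitaries -/
  UA : ℕ → Matrix (A × M) (A × M) ℂ
  /-- Alice's projectors -/
  EA : ℕ → Matrix (A × M) (A × M) ℂ
  /-- Bob's unitaries -/
  UB : ℕ → Matrix (M × B) (M × B) ℂ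
  /-- Bob's projectors -/
  EB : ℕ → Matrix (M × B) (M × B) ℂ
  /-- Alice's final POVM element for the outcome 0 (Alice wins) -/
  FA0 : Matrix A A ℂ
  /-- Alice's final POVM element for the outcome 1 (Bob wins) -/
  FA1 : Matrix A A ℂ
  /-- Bob's final POVM element for the outcome 0 (Alice wins) -/
  FB0 : Matrix B B ℂ
  /-- Bob's final POVM element for the outcome 1 (Bob wins) -/
  FB1 : Matrix B B ℂ

variable {A M B : Type*} [Fintype A] [DecidableEq A] [Fintype M] [DecidableEq M]
  [Fintype B] [DecidableEq B]

namespace Protocol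

/-- `U_i` on the whole space. -/
def U (P : Protocol A M B) (i : ℕ) : Matrix (A × M × B) (A × M × B) ℂ :=
  if Odd i then onAM (P.UA i) else onMB (P.UB i)

/-- `E_i` on the whole space. -/
def E (P : Protocol A M B) (i : ℕ) : Matrix (A × M × B) (A × M × B) ℂ :=
  if Odd i then onAM (P.EA i) else onMB (P.EB i)

/-- The honest states `ψ_i = U_i ⋯ U_1 (ψ_A ⊗ ψ_M ⊗ ψ_B)`. -/
def honest (P : Protocol A M B) : ℕ → (A × M × B → ℂ)
  | 0 => tensorVec P.ψA (tensorVec P.ψM P.ψB)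
  | i + 1 => P.U (i + 1) *ᵥ P.honest i

/-- The protocol is a (correct, balanced) weak coin flipping protocol. -/
structure IsWCF (P : Protocol A M B) : Prop where
  even_n : Even P.n
  unit_ψA : sqNorm P.ψA = 1
  unit_ψM : sqNorm P.ψM = 1
  unit_ψB : sqNorm P.ψB = 1
  unitary_UA : ∀ i, Odd i → i ≤ P.n → P.UA i ∈ Matrix.unitaryGroup (A × M) ℂ
  unitary_UB : ∀ i, Even i → 0 < i → i ≤ P.n → P.UB i ∈ Matrix.unitaryGroup (M × B) ℂ
  proj_EA : ∀ i, Odd i → i ≤ P.n → IsStarProjection (P.EA i)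
  proj_EB : ∀ i, Even i → 0 < i → i ≤ P.n → IsStarProjection (P.EB i)
  E_honest : ∀ i, 0 < i → i ≤ P.n → P.E i *ᵥ P.honest i = P.honest i
  posSemidef_FA0 : P.FA0.PosSemidef
  posSemidef_FA1 : P.FA1.PosSemidef
  sum_FA : P.FA0 + P.FA1 = 1
  posSemidef_FB0 : P.FB0.PosSemidef
  posSemidef_FB1 : P.FB1.PosSemidef
  sum_FB : P.FB0 + P.FB1 = 1
  correct_01 : onAB P.FA0 P.FB1 *ᵥ P.honest P.n = 0
  correct_10 : onAB P.FA1 P.FB0 *ᵥ P.honest P.n = 0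
  balanced_A : sqNorm (onAB P.FA0 P.FB0 *ᵥ P.honest P.n) = 1 / 2
  balanced_B : sqNorm (onAB P.FA1 P.FB1 *ᵥ P.honest P.n) = 1 / 2

/-! ### Cheating

A cheating player has a workspace `ℂ^d` of arbitrary finite dimension and applies an arbitrary
unitary to it and the message space at each of his or her rounds. The honest player follows the
protocol; the state is kept unnormalized, so that its squared norm is the probability that the
honest player has not yet stopped the protocol (by declaring himself or herself the winner). -/

/-- The state after round `i` when Alice is honest and Bob applies `V i` at each even round `i`;
`ω` is the state of the message space and Bob's workspace before the first round. -/
def runB (P : Protocol A M B) {d : ℕ} (ω : M × Fin d → ℂ)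
    (V : ℕ → Matrix (M × Fin d) (M × Fin d) ℂ) : ℕ → (A × M × Fin d → ℂ)
  | 0 => tensorVec P.ψA ω
  | i + 1 =>
    if Odd (i + 1) then onAM (P.EA (i + 1) * P.UA (i + 1)) *ᵥ P.runB ω V i
    else onMB (V (i + 1)) *ᵥ P.runB ω V i

/-- The state after round `i` when Bob is honest and Alice applies `V i` at each odd round `i`;
`ω` is the state of Alice's workspace and the message space before the first round. -/
def runA (P : Protocol A M B) {d : ℕ} (ω : Fin d × M → ℂ)
    (V : ℕ → Matrix (Fin d × M) (Fin d × M) ℂ) : ℕ → (Fin d × M × B → ℂ)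
  | 0 => fun x => ω (x.1, x.2.1) * P.ψB x.2.2
  | i + 1 =>
    if Odd (i + 1) then onAM (V (i + 1)) *ᵥ P.runA ω V i
    else onMB (P.EB (i + 1) * P.UB (i + 1)) *ᵥ P.runA ω V i

/-- The probability that honest Alice outputs 1 against Bob's strategy. -/
def winB (P : Protocol A M B) {d : ℕ} (ω : M × Fin d → ℂ)
    (V : ℕ → Matrix (M × Fin d) (M × Fin d) ℂ) : ℝ :=
  (braket (P.runB ω V P.n) (onAB P.FA1 (1 : Matrix (Fin d) (Fin d) ℂ) *ᵥ P.runB ω V P.n)).re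

/-- The probability that honest Bob outputs 0 against Alice's strategy. -/
def winA (P : Protocol A M B) {d : ℕ} (ω : Fin d × M → ℂ)
    (V : ℕ → Matrix (Fin d × M) (Fin d × M) ℂ) : ℝ :=
  (braket (P.runA ω V P.n) (onAB (1 : Matrix (Fin d) (Fin d) ℂ) P.FB0 *ᵥ P.runA ω V P.n)).re

/-- Bob's optimal cheating probability `P_B^*`. Alice prepares the message space in the state `ψ_M`
before her first round; Bob prepares an arbitrary state of his workspace. -/
def optB (P : Protocol A M B) : ℝ :=
  sSup {p : ℝ | ∃ (d : ℕ) (χ : Fin d → ℂ) (V : ℕ → Matrix (M × Fin d) (M × Fin d) ℂ),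
    sqNorm χ = 1 ∧ (∀ i, V i ∈ Matrix.unitaryGroup (M × Fin d) ℂ) ∧
    p = P.winB (tensorVec P.ψM χ) V}

/-- Bob's optimal cheating probability when, in addition, he can access the message space before the
first round, so that he prepares an arbitrary joint state of the message space and his workspace.
This is the value of the semidefinite program in which the initial state `ρ` of `𝒜 ⊗ ℳ` is only
constrained by `tr_ℳ ρ = |ψ_A⟩⟨ψ_A|`. -/
def optBEarly (P : Protocol A M B) : ℝ :=
  sSup {p : ℝ | ∃ (d : ℕ) (ω : M × Fin d → ℂ) (V : ℕ → Matrix (M × Fin d) (M × Fin d) ℂ),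
    sqNorm ω = 1 ∧ (∀ i, V i ∈ Matrix.unitaryGroup (M × Fin d) ℂ) ∧
    p = P.winB ω V}

/-- Alice's optimal cheating probability `P_A^*`. Alice holds the message space before the first
round, so she prepares an arbitrary joint state of her workspace and the message space. -/
def optA (P : Protocol A M B) : ℝ :=
  sSup {p : ℝ | ∃ (d : ℕ) (ω : Fin d × M → ℂ) (V : ℕ → Matrix (Fin d × M) (Fin d × M) ℂ),
    sqNorm ω = 1 ∧ (∀ i, V i ∈ Matrix.unitaryGroup (Fin d × M) ℂ) ∧
    p = P.winA ω V}

/-! ### Dual feasible points -/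

/-- `Z_0, …, Z_n` is a dual feasible point bounding Bob's cheating, with eigenvalue `β`. -/
structure IsDualFeasibleA (P : Protocol A M B) (Z : ℕ → Matrix A A ℂ) (β : ℝ) : Prop where
  posSemidef : ∀ i ≤ P.n, (Z i).PosSemidef
  odd_step : ∀ i, Odd i → i ≤ P.n →
    (Z (i - 1) ⊗ₖ (1 : Matrix M M ℂ) -
      (P.UA i)ᴴ * P.EA i * (Z i ⊗ₖ (1 : Matrix M M ℂ)) * P.EA i * P.UA i).PosSemidef
  even_step : ∀ i, Even i → 0 < i → i ≤ P.n → Z (i - 1) = Z i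
  last : Z P.n = P.FA1
  pos : 0 < β
  eigen : Z 0 *ᵥ P.ψA = (β : ℂ) • P.ψA

/-- `Z_0, …, Z_n` is a dual feasible point bounding Alice's cheating, with eigenvalue `α`. -/
structure IsDualFeasibleB (P : Protocol A M B) (Z : ℕ → Matrix B B ℂ) (α : ℝ) : Prop where
  posSemidef : ∀ i ≤ P.n, (Z i).PosSemidef
  even_step : ∀ i, Even i → 0 < i → i ≤ P.n →
    ((1 : Matrix M M ℂ) ⊗ₖ Z (i - 1) -
      (P.UB i)ᴴ * P.EB i * ((1 : Matrix M M ℂ) ⊗ₖ Z i) * P.EB i * P.UB i).PosSemidef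
  odd_step : ∀ i, Odd i → i ≤ P.n → Z (i - 1) = Z i
  last : Z P.n = P.FB0
  pos : 0 < α
  eigen : Z 0 *ᵥ P.ψB = (α : ℂ) • P.ψB

end Protocol

/-! ### Point games -/

/-- The matrix of the orthogonal projection onto the eigenspace of `Z` for `z` (it is `0` if `z` is
not an eigenvalue). -/
def eigProj {ι : Type*} [Fintype ι] [DecidableEq ι] (Z : Matrix ι ι ℂ) (z : ℝ) : Matrix ι ι ℂ :=
  Matrix.toEuclideanLin.symm
    (Module.End.eigenspace (Matrix.toEuclideanLin Z) (z : ℂ)).starProjection.toLinearMap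

/-- `prob[Z, ψ]`. -/
def prob {ι : Type*} [Fintype ι] [DecidableEq ι] (Z : Matrix ι ι ℂ) (ψ : ι → ℂ) (z : ℝ≥0) : ℝ :=
  (braket ψ (eigProj Z z *ᵥ ψ)).re

/-- `prob[Z_A, Z_B, ψ]`. -/
def prob₂ (ZA : Matrix A A ℂ) (ZB : Matrix B B ℂ) (ψ : A × M × B → ℂ) (z : ℝ≥0 × ℝ≥0) : ℝ :=
  (braket ψ (onAB (eigProj ZA z.1) (eigProj ZB z.2) *ᵥ ψ)).re

/-- The line transition `l → r` is expressible by matrices. -/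
def EBMLine (l r : ℝ≥0 → ℝ) : Prop :=
  ∃ (d : ℕ) (X Y : Matrix (Fin d) (Fin d) ℂ) (ψ : Fin d → ℂ),
    X.PosSemidef ∧ (Y - X).PosSemidef ∧ l = prob X ψ ∧ r = prob Y ψ

/-- EBM horizontal transition: the first coordinate moves. -/
def EBMHorizontal (p q : ℝ≥0 × ℝ≥0 → ℝ) : Prop :=
  ∀ y, EBMLine (fun x => p (x, y)) (fun x => q (x, y))

/-- EBM vertical transition: the second coordinate moves. -/
def EBMVertical (p q : ℝ≥0 × ℝ≥0 → ℝ) : Prop :=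
  ∀ x, EBMLine (fun y => p (x, y)) (fun y => q (x, y))

/-- The function `[x, y]`, equal to `1` at `(x, y)` and to `0` elsewhere. -/
def point (x y : ℝ≥0) : ℝ≥0 × ℝ≥0 → ℝ := fun z => if z = (x, y) then 1 else 0

/-- `p_0, …, p_n` is an EBM point game with final point `[β, α]`. -/
structure IsEBMPointGame (n : ℕ) (p : ℕ → ℝ≥0 × ℝ≥0 → ℝ) (β α : ℝ≥0) : Prop where
  nonneg : ∀ i ≤ n, ∀ z, 0 ≤ p i z
  finite_support : ∀ i ≤ n, (Function.support (p i)).Finite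
  init : p 0 = (1 / 2 : ℝ) • point 0 1 + (1 / 2 : ℝ) • point 1 0
  vertical : ∀ i < n, Even i → EBMVertical (p i) (p (i + 1))
  horizontal : ∀ i < n, Odd i → EBMHorizontal (p i) (p (i + 1))
  final : p n = point β α

end

end CoinFlip

/-!
A cheating player meets an honest one only through the sequence of reduced states of the honest
player's workspace and the message space. By the unitary freedom of purifications, every sequence
compatible with the marginal conditions comes from a strategy with a workspace of bounded dimension,
so the optimal cheating probability is the value of a semidefinite program. Convex separation, round
by round from the last one, then gives for every number above this value a dual chain `Z_0, …, Z_n`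
whose operator inequalities are all strict. Since `⟨ψ, Z_0 ψ⟩ < β`, the matrix `Z_0` may be replaced
by a larger one having `ψ` as an eigenvector for `β`.

Strictness is what turns an inequality `Y ≻ U† E Z E U` between compressions into an inequality
`X ⪯ Y'` between matrices: `Z` is dilated to a unitarily equivalent block matrix on twice the space,
and a large multiple of the identity on the second copy absorbs the off-diagonal blocks. As `E`
fixes the honest state, that state lies in the first copy, and both sides keep their spectral
distribution in it, so every round, read backwards, is an EBM transition.

An honest first message cannot be tampered with by Bob before it is sent, so against `P_B^*` the
chain stops after round `1`, at `⟨ψ_1, (Z_1 ⊗ 1) ψ_1⟩ < β`. The last transition then goes from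
`Z_1` to a matrix on the whole space having `ψ_1` as an eigenvector for `β`.
-/

namespace CoinFlip

section Duality

open scoped Pointwise

variable {E V : Type*} [AddCommGroup E] [Module ℝ E] [AddCommGroup V] [Module ℝ V]

theorem eq_zero_or_mem_convexConeHull_of_mem_hull {T : Set E} {x : E}
    (hx : x ∈ PointedCone.hull ℝ T) : x = 0 ∨ x ∈ ConvexCone.hull ℝ T := by
  induction hx using Submodule.span_induction with
  | mem x hx => exact .inr (ConvexCone.subset_hull hx)
  | zero => exact .inl rfl
  | add x y _ _ hx hy =>
    rcases hx with rfl | hx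
    · simpa using hy
    rcases hy with rfl | hy
    · simpa using Or.inr hx
    exact .inr (ConvexCone.add_mem _ hx hy)
  | smul r x _ hx =>
    rcases hx with rfl | hx
    · exact .inl (smul_zero r)
    rcases eq_or_lt_of_le r.2 with hr | hr
    · exact .inl (by rw [show r = 0 from Subtype.ext hr.symm, zero_smul])
    · exact .inr (ConvexCone.smul_mem _ hr hx)

theorem nonneg_of_forall_le_mul_add {a b t : ℝ} (h : ∀ r : ℝ, 0 ≤ r → t ≤ r * a + b) : 0 ≤ a := by
  by_contra! ha
  have h' := h ((|b - t| + 1) / -a) (div_nonneg (by positivity) (neg_nonneg.2 ha.le))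
  rw [div_mul_eq_mul_div, mul_div_assoc, div_neg, div_self ha.ne] at h'
  linarith [le_abs_self (b - t)]

theorem exists_nonneg_extension (K : PointedCone ℝ E) (f : V →ₗ[ℝ] E) (g : V →ₗ[ℝ] ℝ)
    (hg : ∀ v, f v ∈ K → 0 ≤ g v) (hK : ∀ X, ∃ v, f v + X ∈ K) :
    ∃ ℓ : E →ₗ[ℝ] ℝ, (∀ v, ℓ (f v) = g v) ∧ ∀ X ∈ K, 0 ≤ ℓ X := by
  obtain ⟨lift, hlift⟩ := f.rangeRestrict.exists_rightInverse_of_surjective f.range_rangeRestrict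
  replace hlift (y : f.range) : f (lift y) = y :=
    congrArg Subtype.val (LinearMap.congr_fun hlift y)
  have hker (v : V) (hv : f v = 0) : g v = 0 := by
    have hneg := hg (-v) (by rw [map_neg, hv, neg_zero]; exact K.zero_mem)
    rw [map_neg] at hneg
    exact le_antisymm (neg_nonneg.1 hneg) (hg v (hv ▸ K.zero_mem))
  obtain ⟨ℓ, hℓg, hℓK⟩ := riesz_extension K ⟨f.range, g ∘ₗ lift⟩
    (fun y hy => hg (lift y) ((hlift y).symm ▸ hy))
    (fun X => let ⟨v, hv⟩ := hK X; ⟨f.rangeRestrict v, hv⟩)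
  refine ⟨ℓ, fun v => (hℓg (f.rangeRestrict v)).trans ?_, hℓK⟩
  change g (lift (f.rangeRestrict v)) = g v
  rw [← sub_eq_zero, ← map_sub]
  exact hker _ (by rw [map_sub, hlift]; exact sub_self _)

section

variable {K : PointedCone ℝ E} {S : Set E} {f : V →ₗ[ℝ] E} {g : V →ₗ[ℝ] ℝ} {t : ℝ}

theorem nonneg_of_mem_hull_prod (hS : Convex ℝ S) (h : ∀ Q ∈ S, ∀ v, f v - Q ∈ K → t ≤ g v)
    {Q₀ : E} (hQ₀ : Q₀ ∈ S) {v₀ : V} (hv₀ : f v₀ - Q₀ ∈ K) {v : V} {s : ℝ}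
    (hvs : (f v, s) ∈ PointedCone.hull ℝ (((K : Set E) + S) ×ˢ {-t})) : 0 ≤ g v + s := by
  rcases eq_zero_or_mem_convexConeHull_of_mem_hull hvs with h0 | hvs
  · obtain ⟨hv, rfl⟩ := Prod.mk_eq_zero.1 h0
    rw [add_zero]
    refine nonneg_of_forall_le_mul_add (b := g v₀) (t := t) fun r _ => ?_
    rw [← smul_eq_mul, ← map_smul, ← map_add]
    exact h Q₀ hQ₀ _ (by rwa [map_add, map_smul, hv, smul_zero, zero_add])
  · obtain ⟨r, hr, ⟨_, _⟩, ⟨⟨P, hP, Q, hQ, rfl⟩, rfl⟩, heq⟩ := (ConvexCone.mem_hull_of_convex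
      ((K.convex.add hS).prod (convex_singleton (-t)))).1 hvs
    have hv : r • (P + Q) = f v := congrArg Prod.fst heq
    have hs : r * -t = s := congrArg Prod.snd heq
    have ht := h Q hQ (r⁻¹ • v) (by
      rwa [map_smul, ← hv, inv_smul_smul₀ hr.ne', add_sub_cancel_right])
    rw [map_smul, smul_eq_mul, ← div_eq_inv_mul, le_div_iff₀ hr] at ht
    linarith

/-- The functional `(X, s) ↦ ℓ X + s` extends `(f v, s) ↦ g v + s`, and is nonnegative on the cone
spanned by `(K + S) × {-t}`. -/
theorem exists_dual_functional (hS : Convex ℝ S) (hne : S.Nonempty) (hK : ∀ X, ∃ v, f v - X ∈ K)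
    (h : ∀ Q ∈ S, ∀ v, f v - Q ∈ K → t ≤ g v) :
    ∃ ℓ : E →ₗ[ℝ] ℝ, (∀ v, ℓ (f v) = g v) ∧ (∀ X ∈ K, 0 ≤ ℓ X) ∧ ∀ Q ∈ S, t ≤ ℓ Q := by
  obtain ⟨Q₀, hQ₀⟩ := hne
  obtain ⟨v₀, hv₀⟩ := hK Q₀
  let T : Set (E × ℝ) := ((K : Set E) + S) ×ˢ {-t}
  have hdense (x : E × ℝ) : ∃ v, f.prodMap LinearMap.id v + x ∈ PointedCone.hull ℝ T := by
    obtain ⟨v, hv⟩ := hK (Q₀ - x.1)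
    refine ⟨(v, -t - x.2), PointedCone.subset_hull
      ⟨⟨f v - (Q₀ - x.1), hv, Q₀, hQ₀, ?_⟩, sub_add_cancel _ _⟩⟩
    change f v - (Q₀ - x.1) + Q₀ = f v + x.1
    abel
  obtain ⟨L, hLg, hLT⟩ := exists_nonneg_extension (PointedCone.hull ℝ T)
    (f.prodMap LinearMap.id) (g.coprod LinearMap.id)
    (fun _ hx => nonneg_of_mem_hull_prod hS h hQ₀ hv₀ hx) hdense
  let ℓ : E →ₗ[ℝ] ℝ := L ∘ₗ LinearMap.inl ℝ E ℝ
  have hKS (P : E) (hP : P ∈ K) (Q : E) (hQ : Q ∈ S) : t ≤ ℓ P + ℓ Q := by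
    have hLt : L (0, -t) = -t := by simpa using hLg (0, -t)
    have hLPQ := hLT (P + Q, -t) (PointedCone.subset_hull ⟨⟨P, hP, Q, hQ, rfl⟩, rfl⟩)
    rw [show (P + Q, -t) = (P, 0) + (Q, 0) + (0, -t) by simp, map_add, map_add, hLt] at hLPQ
    change t ≤ L (P, 0) + L (Q, 0)
    linarith
  refine ⟨ℓ, fun v => ?_, fun X hX => ?_, fun Q hQ => ?_⟩
  · simpa [ℓ] using hLg (v, 0)
  · refine nonneg_of_forall_le_mul_add (b := ℓ Q₀) (t := t) fun r hr => ?_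
    rw [← smul_eq_mul, ← map_smul]
    exact hKS (r • X) (K.smul_mem hr hX) Q₀ hQ₀
  · simpa using hKS 0 K.zero_mem Q hQ

end

end Duality

section MatrixDuality

variable {n : Type*} [Fintype n]

section

open scoped MatrixOrder Matrix.Norms.L2Operator

theorem exists_smul_one_sub_posDef {n : Type*} [Finite n] [DecidableEq n] {X : Matrix n n ℂ}
    (hX : X.IsHermitian) : ∃ c : ℝ, (c • (1 : Matrix n n ℂ) - X).PosDef := by
  have := Fintype.ofFinite n
  have hle : (algebraMap ℝ (Matrix n n ℂ) ‖X‖ - X).PosSemidef :=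
    IsSelfAdjoint.le_algebraMap_norm_self (a := X) hX
  refine ⟨‖X‖ + 1, ?_⟩
  rw [add_smul, one_smul, add_sub_right_comm, ← Algebra.algebraMap_eq_smul_one]
  exact Matrix.PosDef.one.posSemidef_add hle

end

/-- The accretive matrices, i.e. those with positive semidefinite Hermitian part, as a cone. Unlike
the cone of positive semidefinite matrices it has `1` in its interior within the real vector space
of all matrices, as the extension of functionals that are nonnegative on it requires. -/
def accretiveCone (n : Type*) [Fintype n] : PointedCone ℝ (Matrix n n ℂ) where
  carrier := {X | (X + Xᴴ).PosSemidef}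
  add_mem' {X Y} hX hY := by
    have h : X + Y + (X + Y)ᴴ = X + Xᴴ + (Y + Yᴴ) := by
      rw [Matrix.conjTranspose_add]
      abel
    exact (congrArg Matrix.PosSemidef h).mpr (hX.add hY)
  zero_mem' := by simpa using Matrix.PosSemidef.zero
  smul_mem' r X hX := by
    have h : r • X + (r • X)ᴴ = (r : ℝ) • (X + Xᴴ) := by
      change (r : ℝ) • X + ((r : ℝ) • X)ᴴ = _
      rw [Matrix.conjTranspose_smul, star_trivial, smul_add]
    exact (congrArg Matrix.PosSemidef h).mpr (hX.smul r.2)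

theorem mem_accretiveCone {X : Matrix n n ℂ} : X ∈ accretiveCone n ↔ (X + Xᴴ).PosSemidef := .rfl

theorem mem_accretiveCone_of_posSemidef {X : Matrix n n ℂ} (hX : X.PosSemidef) :
    X ∈ accretiveCone n := by
  rw [mem_accretiveCone, hX.isHermitian.eq]
  exact hX.add hX

theorem mem_accretiveCone_of_conjTranspose_eq_neg {X : Matrix n n ℂ} (hX : Xᴴ = -X) :
    X ∈ accretiveCone n := by
  rw [mem_accretiveCone, hX, add_neg_cancel]
  exact .zero

theorem re_trace_conjTranspose (X : Matrix n n ℂ) : Xᴴ.trace.re = X.trace.re := by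
  rw [Matrix.trace_conjTranspose, Complex.star_def, Complex.conj_re]

theorem exists_forall_eq_re_trace_mul {m : Type*} [Fintype m] (g : Matrix m n ℂ →ₗ[ℝ] ℝ) :
    ∃ ρ : Matrix n m ℂ, ∀ X, g X = (ρ * X).trace.re := by
  classical
  let G : Matrix m n ℂ →ₗ[ℂ] ℂ := Module.Dual.extendRCLike g
  let ρ : Matrix n m ℂ := .of fun j i => G (Matrix.single i j 1)
  have hρ (X : Matrix m n ℂ) : (ρ * X).trace = G X := by
    conv_rhs => rw [Matrix.matrix_eq_sum_single X]
    simp only [Matrix.trace, Matrix.diag, Matrix.mul_apply, map_sum, ρ, Matrix.of_apply]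
    rw [Finset.sum_comm]
    refine Finset.sum_congr rfl fun i _ => Finset.sum_congr rfl fun j _ => ?_
    have hsingle : Matrix.single i j (X i j) = X i j • Matrix.single i j (1 : ℂ) := by
      rw [Matrix.smul_single, smul_eq_mul, mul_one]
    rw [hsingle, map_smul, smul_eq_mul, mul_comm]
  exact ⟨ρ, fun X => by simp [hρ, G, Module.Dual.extendRCLike_apply]⟩

theorem isHermitian_of_re_trace_mul_eq_zero {ρ : Matrix n n ℂ}
    (h : ∀ X, Xᴴ = -X → (ρ * X).trace.re = 0) : ρ.IsHermitian := by
  have hskew : (ρ - ρᴴ)ᴴ = -(ρ - ρᴴ) := by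
    rw [Matrix.conjTranspose_sub, Matrix.conjTranspose_conjTranspose, neg_sub]
  have hre : ((ρ - ρᴴ) * (ρ - ρᴴ)).trace.re = 0 := by
    have hconj : (ρᴴ * (ρ - ρᴴ)).trace.re = -(ρ * (ρ - ρᴴ)).trace.re := by
      rw [← re_trace_conjTranspose, Matrix.conjTranspose_mul, hskew,
        Matrix.conjTranspose_conjTranspose, Matrix.neg_mul, Matrix.trace_neg, Complex.neg_re,
        Matrix.trace_mul_comm]
    rw [Matrix.sub_mul, Matrix.trace_sub, Complex.sub_re, hconj, h _ hskew]
    simp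
  have htrace : ((ρ - ρᴴ)ᴴ * (ρ - ρᴴ)).trace = 0 := by
    have hnonneg := (Matrix.posSemidef_conjTranspose_mul_self (ρ - ρᴴ)).trace_nonneg
    refine Complex.ext ?_ (Complex.nonneg_iff.1 hnonneg).2.symm
    rw [hskew, Matrix.neg_mul, Matrix.trace_neg, Complex.neg_re, hre, neg_zero, Complex.zero_re]
  exact (sub_eq_zero.1 (Matrix.trace_conjTranspose_mul_self_eq_zero_iff.1 htrace)).symm

theorem posSemidef_of_re_trace_mul_nonneg {ρ : Matrix n n ℂ}
    (h : ∀ X ∈ accretiveCone n, 0 ≤ (ρ * X).trace.re) : ρ.PosSemidef := by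
  have hherm : ρ.IsHermitian := by
    refine isHermitian_of_re_trace_mul_eq_zero fun X hX => le_antisymm ?_
      (h X (mem_accretiveCone_of_conjTranspose_eq_neg hX))
    have hneg := h (-X) (mem_accretiveCone_of_conjTranspose_eq_neg (by
      rw [Matrix.conjTranspose_neg, hX]))
    rwa [Matrix.mul_neg, Matrix.trace_neg, Complex.neg_re, neg_nonneg] at hneg
  refine .of_dotProduct_mulVec_nonneg hherm fun v => Complex.nonneg_iff.2
    ⟨?_, (hherm.im_star_dotProduct_mulVec_self v).symm⟩
  have hv := h _ (mem_accretiveCone_of_posSemidef (Matrix.posSemidef_vecMulVec_self_star v))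
  rwa [Matrix.mul_vecMulVec, Matrix.trace_vecMulVec, dotProduct_comm] at hv

variable {H M : Type*} [Fintype H] [Fintype M] [DecidableEq M]

/-- The map `Z ↦ Z ⊗ 1`, as a real linear map. -/
def kroneckerOne (H M : Type*) [DecidableEq M] :
    Matrix H H ℂ →ₗ[ℝ] Matrix (H × M) (H × M) ℂ where
  toFun Z := Z ⊗ₖ 1
  map_add' Z Z' := Matrix.add_kronecker Z Z' 1
  map_smul' r Z := Matrix.smul_kronecker r Z 1

theorem exists_kroneckerOne_sub_mem_accretiveCone (X : Matrix (H × M) (H × M) ℂ) :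
    ∃ Z, kroneckerOne H M Z - X ∈ accretiveCone (H × M) := by
  classical
  obtain ⟨c, hc⟩ := exists_smul_one_sub_posDef (X := X + Xᴴ)
    (Matrix.isHermitian_add_transpose_self X)
  have hone : kroneckerOne H M 1 = 1 := Matrix.one_kronecker_one
  refine ⟨(c / 2) • 1, mem_accretiveCone.2 ?_⟩
  convert hc.posSemidef using 1
  rw [map_smul, hone, Matrix.conjTranspose_sub, Matrix.conjTranspose_smul, star_trivial,
    Matrix.conjTranspose_one]
  module

theorem le_re_trace_mul_of_sub_mem_accretiveCone {Q : Matrix (H × M) (H × M) ℂ}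
    (hQ : Q.IsHermitian) {σ : Matrix H H ℂ} (hσ : σ.IsHermitian) {t : ℝ}
    (h : ∀ Z : Matrix H H ℂ, (Z ⊗ₖ (1 : Matrix M M ℂ) - Q).PosDef → t ≤ (Z * σ).trace.re)
    {Z : Matrix H H ℂ} (hZ : kroneckerOne H M Z - Q ∈ accretiveCone (H × M)) :
    t ≤ (Z * σ).trace.re := by
  classical
  have hconj : (Zᴴ * σ).trace.re = (Z * σ).trace.re := by
    rw [← re_trace_conjTranspose, Matrix.conjTranspose_mul, Matrix.conjTranspose_conjTranspose,
      hσ.eq, Matrix.trace_mul_comm]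
  have hε (ε : ℝ) (hε : 0 < ε) : t ≤ (Z * σ).trace.re + ε * σ.trace.re := by
    have hdef : (((1 / 2 : ℝ) • (Z + Zᴴ) + ε • 1) ⊗ₖ (1 : Matrix M M ℂ) - Q).PosDef := by
      convert (Matrix.PosDef.one.smul hε).add_posSemidef
        ((mem_accretiveCone.1 hZ).smul (show (0 : ℝ) ≤ 1 / 2 by norm_num)) using 1
      change kroneckerOne H M _ - Q = _
      have hone : kroneckerOne H M 1 = 1 := Matrix.one_kronecker_one
      have hstar : (kroneckerOne H M Z)ᴴ = kroneckerOne H M Zᴴ := by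
        rw [kroneckerOne, LinearMap.coe_mk, AddHom.coe_mk, Matrix.conjTranspose_kronecker,
          Matrix.conjTranspose_one]
      rw [map_add, map_smul, map_smul, map_add, hone, Matrix.conjTranspose_sub, hstar, hQ.eq]
      module
    refine (h _ hdef).trans_eq ?_
    rw [Matrix.add_mul, Matrix.smul_mul, Matrix.smul_mul, Matrix.add_mul, Matrix.one_mul,
      Matrix.trace_add, Matrix.trace_smul, Matrix.trace_smul, Matrix.trace_add, Complex.add_re,
      Complex.smul_re, Complex.smul_re, Complex.add_re, hconj, smul_eq_mul, smul_eq_mul]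
    ring
  have hlim : Filter.Tendsto (fun ε : ℝ => (Z * σ).trace.re + ε * σ.trace.re)
      (nhdsWithin 0 (Set.Ioi 0)) (nhds ((Z * σ).trace.re + 0 * σ.trace.re)) :=
    (Continuous.tendsto (by fun_prop) 0).mono_left nhdsWithin_le_nhds
  rw [zero_mul, add_zero] at hlim
  exact ge_of_tendsto hlim (Filter.eventually_of_mem self_mem_nhdsWithin hε)

theorem exists_posSemidef_marginal_of_forall_posDef {S : Set (Matrix (H × M) (H × M) ℂ)}
    (hS : Convex ℝ S) (hne : S.Nonempty) (hherm : ∀ Q ∈ S, Q.IsHermitian)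
    {σ : Matrix H H ℂ} (hσ : σ.IsHermitian)
    {t : ℝ} (h : ∀ Q ∈ S, ∀ Z : Matrix H H ℂ, (Z ⊗ₖ (1 : Matrix M M ℂ) - Q).PosDef →
      t ≤ (Z * σ).trace.re) :
    ∃ ρ : Matrix (H × M) (H × M) ℂ, ρ.PosSemidef ∧
      (∀ Z : Matrix H H ℂ, (ρ * (Z ⊗ₖ (1 : Matrix M M ℂ))).trace.re = (Z * σ).trace.re) ∧
      ∀ Q ∈ S, t ≤ (ρ * Q).trace.re := by
  let g : Matrix H H ℂ →ₗ[ℝ] ℝ :=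
    Complex.reLm ∘ₗ Matrix.traceLinearMap H ℝ ℂ ∘ₗ LinearMap.mulRight ℝ σ
  obtain ⟨ℓ, hℓg, hℓK, hℓS⟩ := exists_dual_functional (g := g) hS hne
    exists_kroneckerOne_sub_mem_accretiveCone
    fun Q hQ Z => le_re_trace_mul_of_sub_mem_accretiveCone (hherm Q hQ) hσ (h Q hQ)
  obtain ⟨ρ, hρ⟩ := exists_forall_eq_re_trace_mul ℓ
  exact ⟨ρ, posSemidef_of_re_trace_mul_nonneg fun X hX => hρ X ▸ hℓK X hX,
    fun Z => (hρ _).symm.trans (hℓg Z), fun Q hQ => hρ Q ▸ hℓS Q hQ⟩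

end MatrixDuality

section UnitaryFreedom

theorem exists_linearIsometry_comp_eq {𝕜 E S : Type*} [RCLike 𝕜] [AddCommGroup E] [Module 𝕜 E]
    [NormedAddCommGroup S] [InnerProductSpace 𝕜 S] [FiniteDimensional 𝕜 S] {T T' : E →ₗ[𝕜] S}
    (h : ∀ x, ‖T x‖ = ‖T' x‖) : ∃ L : S →ₗᵢ[𝕜] S, ∀ x, L (T x) = T' x := by
  obtain ⟨f, hf⟩ := T.rangeRestrict.exists_rightInverse_of_surjective T.range_rangeRestrict
  have hTf (s : LinearMap.range T) : T (f s) = s :=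
    congrArg Subtype.val (LinearMap.congr_fun hf s)
  let L : LinearMap.range T →ₗᵢ[𝕜] S :=
    ⟨T' ∘ₗ f, fun s => by rw [LinearMap.comp_apply, ← h, hTf, Submodule.coe_norm]⟩
  refine ⟨L.extend, fun x => ?_⟩
  have hext : L.extend (T x) = T' (f (T.rangeRestrict x)) := L.extend_apply (T.rangeRestrict x)
  rw [hext, ← sub_eq_zero, ← norm_eq_zero, ← map_sub, ← h, map_sub, hTf]
  exact norm_eq_zero.2 (sub_self _)

theorem exists_mem_unitaryGroup_mulVec_eq {ι : Type*} [Fintype ι] [DecidableEq ι]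
    (L : EuclideanSpace ℂ ι →ₗᵢ[ℂ] EuclideanSpace ℂ ι) :
    ∃ V ∈ Matrix.unitaryGroup ι ℂ, ∀ v, V *ᵥ v = (L (WithLp.toLp 2 v)).ofLp := by
  let b := EuclideanSpace.basisFun ι ℂ
  refine ⟨_, (L.toLinearIsometryEquiv rfl).toMatrix_mem_unitaryGroup b b, fun v => ?_⟩
  exact LinearMap.toMatrix_mulVec_repr b.toBasis b.toBasis L.toLinearMap (WithLp.toLp 2 v)

variable {ι κ : Type*} [Fintype κ]

theorem norm_toEuclideanLin_conjTranspose_sq [Fintype ι] [DecidableEq ι] (Φ : Matrix ι κ ℂ)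
    (x : EuclideanSpace ℂ ι) :
    ((‖Matrix.toEuclideanLin Φᴴ x‖ ^ 2 : ℝ) : ℂ) = star x.ofLp ⬝ᵥ ((Φ * Φᴴ) *ᵥ x.ofLp) := by
  rw [Complex.ofReal_pow]
  refine (inner_self_eq_norm_sq_to_K (𝕜 := ℂ) (Matrix.toEuclideanLin Φᴴ x)).symm.trans ?_
  rw [EuclideanSpace.inner_eq_star_dotProduct, ← Matrix.mulVec_mulVec, Matrix.dotProduct_mulVec,
    dotProduct_comm, Matrix.ofLp_toLpLin, Matrix.toLin'_apply, Matrix.star_mulVec,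
    Matrix.conjTranspose_conjTranspose]

theorem exists_mem_unitaryGroup_eq_mul [Finite ι] [DecidableEq κ] {Φ Χ : Matrix ι κ ℂ}
    (h : Φ * Φᴴ = Χ * Χᴴ) : ∃ W ∈ Matrix.unitaryGroup κ ℂ, Χ = Φ * W := by
  classical
  have := Fintype.ofFinite ι
  have hnorm (x : EuclideanSpace ℂ ι) :
      ‖Matrix.toEuclideanLin Φᴴ x‖ = ‖Matrix.toEuclideanLin Χᴴ x‖ := by
    refine (sq_eq_sq₀ (norm_nonneg _) (norm_nonneg _)).1 (Complex.ofReal_injective ?_)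
    rw [norm_toEuclideanLin_conjTranspose_sq, norm_toEuclideanLin_conjTranspose_sq, h]
  obtain ⟨L, hL⟩ := exists_linearIsometry_comp_eq hnorm
  obtain ⟨V, hV, hVL⟩ := exists_mem_unitaryGroup_mulVec_eq L
  have hVΦ : V * Φᴴ = Χᴴ := Matrix.ext_iff_mulVec.2 fun x => by
    rw [← Matrix.mulVec_mulVec, hVL]
    exact congrArg WithLp.ofLp (hL (WithLp.toLp 2 x))
  refine ⟨star V, Unitary.star_mem hV, ?_⟩
  rw [← Matrix.conjTranspose_conjTranspose Χ, ← hVΦ, Matrix.conjTranspose_mul,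
    Matrix.conjTranspose_conjTranspose, Matrix.star_eq_conjTranspose]

end UnitaryFreedom

section EigenProjection

theorem star_mulVec_dotProduct {ι κ : Type*} [Fintype ι] [Fintype κ] (X : Matrix κ ι ℂ)
    (v : ι → ℂ) (w : κ → ℂ) : star (X *ᵥ v) ⬝ᵥ w = star v ⬝ᵥ (Xᴴ *ᵥ w) := by
  rw [Matrix.star_mulVec, Matrix.dotProduct_mulVec]

variable {ι κ : Type*} [Fintype ι] [DecidableEq ι] [Fintype κ] [DecidableEq κ]

theorem toEuclideanLin_eigProj (Z : Matrix ι ι ℂ) (z : ℝ) :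
    Matrix.toEuclideanLin (eigProj Z z) =
      (Module.End.eigenspace (Matrix.toEuclideanLin Z) (z : ℂ)).starProjection.toLinearMap := by
  rw [eigProj, LinearEquiv.apply_symm_apply]

theorem eigProj_mulVec (Z : Matrix ι ι ℂ) (z : ℝ) (v : ι → ℂ) :
    eigProj Z z *ᵥ v = ((Module.End.eigenspace (Matrix.toEuclideanLin Z) (z : ℂ)).starProjection
      (WithLp.toLp 2 v)).ofLp :=
  congrArg WithLp.ofLp (LinearMap.congr_fun (toEuclideanLin_eigProj Z z) (WithLp.toLp 2 v))

theorem mem_eigenspace_toEuclideanLin {Z : Matrix ι ι ℂ} {z : ℂ} {v : EuclideanSpace ℂ ι} :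
    v ∈ Module.End.eigenspace (Matrix.toEuclideanLin Z) z ↔ Z *ᵥ v.ofLp = z • v.ofLp := by
  rw [Module.End.mem_eigenspace_iff]
  exact (WithLp.ofLp_injective 2).eq_iff.symm

theorem mulVec_eigProj_mulVec (Z : Matrix ι ι ℂ) (z : ℝ) (v : ι → ℂ) :
    Z *ᵥ (eigProj Z z *ᵥ v) = (z : ℂ) • (eigProj Z z *ᵥ v) := by
  rw [eigProj_mulVec, ← mem_eigenspace_toEuclideanLin]
  exact Submodule.starProjection_apply_mem _ _

theorem mul_eigProj (Z : Matrix ι ι ℂ) (z : ℝ) : Z * eigProj Z z = (z : ℂ) • eigProj Z z := by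
  refine Matrix.ext_iff_mulVec.2 fun x => ?_
  rw [← Matrix.mulVec_mulVec, mulVec_eigProj_mulVec, Matrix.smul_mulVec]

theorem eigProj_mulVec_eq {Z : Matrix ι ι ℂ} {z : ℝ} {u v : ι → ℂ}
    (hu : Z *ᵥ u = (z : ℂ) • u)
    (ho : ∀ w, Z *ᵥ w = (z : ℂ) • w → star w ⬝ᵥ (v - u) = 0) : eigProj Z z *ᵥ v = u := by
  rw [eigProj_mulVec, Submodule.eq_starProjection_of_mem_of_inner_eq_zero
    (v := WithLp.toLp 2 u) (mem_eigenspace_toEuclideanLin.2 hu)]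
  intro w hw
  rw [inner_eq_zero_symm, EuclideanSpace.inner_eq_star_dotProduct, dotProduct_comm]
  exact ho _ (mem_eigenspace_toEuclideanLin.1 hw)

theorem eigProj_mulVec_of_eigen {Z : Matrix ι ι ℂ} {z : ℝ} {v : ι → ℂ}
    (hv : Z *ᵥ v = (z : ℂ) • v) : eigProj Z z *ᵥ v = v :=
  eigProj_mulVec_eq hv fun w _ => by rw [sub_self, dotProduct_zero]

theorem eigProj_isHermitian (Z : Matrix ι ι ℂ) (z : ℝ) : (eigProj Z z).IsHermitian := by
  rw [← Matrix.isSymmetric_toEuclideanLin_iff, toEuclideanLin_eigProj]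
  exact Submodule.starProjection_isSymmetric _

theorem eigProj_mul_self (Z : Matrix ι ι ℂ) (z : ℝ) :
    eigProj Z z * eigProj Z z = eigProj Z z := by
  refine Matrix.ext_iff_mulVec.2 fun x => ?_
  rw [← Matrix.mulVec_mulVec]
  exact eigProj_mulVec_of_eigen (mulVec_eigProj_mulVec _ _ _)

theorem star_dotProduct_sub_eigProj_mulVec {Z : Matrix ι ι ℂ} {z : ℝ} {w : ι → ℂ}
    (hw : Z *ᵥ w = (z : ℂ) • w) (v : ι → ℂ) : star w ⬝ᵥ (v - eigProj Z z *ᵥ v) = 0 := by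
  rw [← eigProj_mulVec_of_eigen hw, star_mulVec_dotProduct, (eigProj_isHermitian Z z).eq,
    Matrix.mulVec_sub, Matrix.mulVec_mulVec, eigProj_mul_self, sub_self, dotProduct_zero]

theorem eigProj_mul {Z : Matrix ι ι ℂ} (hZ : Z.IsHermitian) (z : ℝ) :
    eigProj Z z * Z = (z : ℂ) • eigProj Z z := by
  have h := congrArg Matrix.conjTranspose (mul_eigProj Z z)
  rwa [Matrix.conjTranspose_mul, Matrix.conjTranspose_smul, hZ.eq, (eigProj_isHermitian Z z).eq,
    Complex.star_def, Complex.conj_ofReal] at h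

theorem eigProj_mulVec_of_ne {Z : Matrix ι ι ℂ} (hZ : Z.IsHermitian) {x z : ℝ} (hxz : x ≠ z)
    {v : ι → ℂ} (hv : Z *ᵥ v = (z : ℂ) • v) : eigProj Z x *ᵥ v = 0 := by
  have h : (z : ℂ) • (eigProj Z x *ᵥ v) = (x : ℂ) • (eigProj Z x *ᵥ v) := by
    rw [← Matrix.mulVec_smul, ← hv, Matrix.mulVec_mulVec, eigProj_mul hZ, Matrix.smul_mulVec]
  rw [← sub_eq_zero, ← sub_smul, smul_eq_zero, sub_eq_zero] at h
  exact h.resolve_left fun h => hxz (by exact_mod_cast h.symm)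

theorem finite_setOf_eigProj_ne_zero (Z : Matrix ι ι ℂ) :
    {z : ℝ≥0 | eigProj Z z ≠ 0}.Finite := by
  refine ((Module.End.finite_hasEigenvalue (Matrix.toEuclideanLin Z)).preimage
    (f := fun z : ℝ≥0 => ((z : ℝ) : ℂ)) fun a _ b _ hab => ?_).subset fun z hz => ?_
  · simpa using hab
  · rw [Set.mem_preimage, Set.mem_ofPred_eq, Module.End.hasEigenvalue_iff]
    intro h
    exact hz ((LinearEquiv.map_eq_zero_iff Matrix.toEuclideanLin).1 (by
      rw [toEuclideanLin_eigProj, h, Submodule.starProjection_bot]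
      rfl))

theorem eigProj_one_sub (Z : Matrix ι ι ℂ) (z : ℝ) : eigProj (1 - Z) (1 - z) = eigProj Z z := by
  refine Matrix.ext_iff_mulVec.2 fun v => eigProj_mulVec_eq ?_ fun w hw =>
    star_dotProduct_sub_eigProj_mulVec ?_ v
  · rw [Matrix.sub_mulVec, Matrix.one_mulVec, mulVec_eigProj_mulVec, Complex.ofReal_sub,
      Complex.ofReal_one, sub_smul, one_smul]
  · rw [Matrix.sub_mulVec, Matrix.one_mulVec, Complex.ofReal_sub, Complex.ofReal_one, sub_smul,
      one_smul] at hw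
    exact sub_right_injective hw

theorem eigProj_mulVec_mulVec_of_intertwine {W : Matrix κ ι ℂ} {Z : Matrix ι ι ℂ}
    {Z' : Matrix κ κ ℂ} (hZ : Z' * W = W * Z) (hZ' : Wᴴ * Z' = Z * Wᴴ) (z : ℝ) (v : ι → ℂ) :
    eigProj Z' z *ᵥ (W *ᵥ v) = W *ᵥ (eigProj Z z *ᵥ v) := by
  refine eigProj_mulVec_eq ?_ fun w hw => ?_
  · rw [Matrix.mulVec_mulVec, hZ, ← Matrix.mulVec_mulVec, mulVec_eigProj_mulVec,
      Matrix.mulVec_smul]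
  · rw [← Matrix.mulVec_sub, ← Matrix.conjTranspose_conjTranspose W, ← star_mulVec_dotProduct]
    refine star_dotProduct_sub_eigProj_mulVec ?_ v
    rw [Matrix.mulVec_mulVec, ← hZ', ← Matrix.mulVec_mulVec, hw, Matrix.mulVec_smul]

theorem prob_mulVec_of_intertwine {W : Matrix κ ι ℂ} (hW : Wᴴ * W = 1) {Z : Matrix ι ι ℂ}
    {Z' : Matrix κ κ ℂ} (hZ : Z' * W = W * Z) (hZ' : Wᴴ * Z' = Z * Wᴴ) (v : ι → ℂ) :
    prob Z' (W *ᵥ v) = prob Z v := by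
  funext z
  rw [prob, prob, braket, braket, eigProj_mulVec_mulVec_of_intertwine hZ hZ',
    star_mulVec_dotProduct, Matrix.mulVec_mulVec _ Wᴴ, hW, Matrix.one_mulVec]

theorem prob_conj {W : Matrix κ ι ℂ} (hW : Wᴴ * W = 1) (Z : Matrix ι ι ℂ) (v : ι → ℂ) :
    prob (W * Z * Wᴴ) (W *ᵥ v) = prob Z v :=
  prob_mulVec_of_intertwine hW (by rw [Matrix.mul_assoc, hW, Matrix.mul_one])
    (by rw [← Matrix.mul_assoc, ← Matrix.mul_assoc, hW, Matrix.one_mul]) v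

theorem prob_fromBlocks_elim_zero (X : Matrix ι ι ℂ) (Y : Matrix κ κ ℂ) (v : ι → ℂ) :
    prob (Matrix.fromBlocks X 0 0 Y) (Sum.elim v 0) = prob X v := by
  let W : Matrix (ι ⊕ κ) ι ℂ := Matrix.fromRows 1 0
  have hW : Wᴴ = Matrix.fromCols 1 0 := by
    rw [Matrix.conjTranspose_fromRows_eq_fromCols_conjTranspose, Matrix.conjTranspose_one,
      Matrix.conjTranspose_zero]
  have hv : Sum.elim v 0 = W *ᵥ v := by
    rw [Matrix.fromRows_mulVec, Matrix.one_mulVec, Matrix.zero_mulVec]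
  rw [hv]
  refine prob_mulVec_of_intertwine ?_ ?_ ?_ v
  · rw [hW, Matrix.fromCols_mul_fromRows, Matrix.one_mul, Matrix.zero_mul, add_zero]
  · simp [W, Matrix.fromRows_mul, Matrix.fromBlocks_mul_fromRows]
  · simp [hW, Matrix.mul_fromCols, Matrix.fromCols_mul_fromBlocks]

end EigenProjection

section Dilation

variable {ι κ μ : Type*} [Fintype ι]

theorem exists_fromBlocks_sub_posSemidef [Finite κ] [Finite μ] [DecidableEq μ] {Z : Matrix ι ι ℂ}
    (hZ : Z.IsHermitian) {Y : Matrix κ κ ℂ} {R : Matrix κ ι ℂ} (S : Matrix μ ι ℂ)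
    (h : (Y - R * Z * Rᴴ).PosDef) :
    ∃ c : ℝ, (Matrix.fromBlocks Y 0 0 (c • 1) -
      Matrix.fromRows R S * Z * (Matrix.fromRows R S)ᴴ).PosSemidef := by
  classical
  have := Fintype.ofFinite κ
  have := Fintype.ofFinite μ
  let Q : Matrix κ μ ℂ := -(R * Z * Sᴴ)
  obtain ⟨c, hcS⟩ := exists_smul_one_sub_posDef
    (X := S * Z * Sᴴ + Qᴴ * (Y - R * Z * Rᴴ)⁻¹ * Q)
    ((Matrix.isHermitian_mul_mul_conjTranspose _ hZ).add
      (Matrix.isHermitian_conjTranspose_mul_mul _ h.inv.isHermitian))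
  refine ⟨c, ?_⟩
  have := h.isUnit.invertible
  have hblocks : Matrix.fromBlocks Y 0 0 (c • 1) -
      Matrix.fromRows R S * Z * (Matrix.fromRows R S)ᴴ =
      Matrix.fromBlocks (Y - R * Z * Rᴴ) Q Qᴴ (c • 1 - S * Z * Sᴴ) := by
    rw [Matrix.conjTranspose_fromRows_eq_fromCols_conjTranspose, Matrix.fromRows_mul,
      Matrix.fromRows_mul_fromCols, sub_eq_add_neg, Matrix.fromBlocks_neg, Matrix.fromBlocks_add,
      zero_add, zero_add, ← sub_eq_add_neg, ← sub_eq_add_neg, Matrix.conjTranspose_neg,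
      Matrix.conjTranspose_mul, Matrix.conjTranspose_mul, hZ.eq, Matrix.conjTranspose_conjTranspose,
      Matrix.mul_assoc S]
  rw [hblocks, Matrix.PosDef.fromBlocks₁₁ _ _ h, sub_sub]
  exact hcS.posSemidef

variable [DecidableEq ι]

theorem conjTranspose_fromRows_mul_fromRows_one_sub [Fintype κ] {R : Matrix κ ι ℂ}
    (hR : IsIdempotentElem (Rᴴ * R)) :
    (Matrix.fromRows R (1 - Rᴴ * R))ᴴ * Matrix.fromRows R (1 - Rᴴ * R) = 1 := by
  rw [Matrix.conjTranspose_fromRows_eq_fromCols_conjTranspose, Matrix.fromCols_mul_fromRows,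
    Matrix.conjTranspose_sub, Matrix.conjTranspose_one,
    (Matrix.isHermitian_conjTranspose_mul_self R).eq, hR.one_sub.eq, add_sub_cancel]

theorem EBMLine.of_posSemidef {X Y : Matrix ι ι ℂ} (hX : X.PosSemidef) (hXY : (Y - X).PosSemidef)
    (ψ : ι → ℂ) : EBMLine (prob X ψ) (prob Y ψ) := by
  let e := (Fintype.equivFin ι).symm
  let W : Matrix (Fin (Fintype.card ι)) ι ℂ := (1 : Matrix ι ι ℂ).submatrix e id
  have hW : Wᴴ * W = 1 := by
    rw [Matrix.conjTranspose_submatrix, Matrix.submatrix_mul_equiv, Matrix.conjTranspose_one,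
      one_mul, Matrix.submatrix_id_id]
  refine ⟨_, W * X * Wᴴ, W * Y * Wᴴ, W *ᵥ ψ, hX.mul_mul_conjTranspose_same W, ?_,
    (prob_conj hW X ψ).symm, (prob_conj hW Y ψ).symm⟩
  rw [← Matrix.sub_mul, ← Matrix.mul_sub]
  exact hXY.mul_mul_conjTranspose_same W

/-- Dilate by the isometry `W = (Uᴴ * E, 1 - E)`: the compression of `Z` becomes the upper left
corner of `W * Z * Wᴴ`, and the lower right corner of the majorant is not seen by the state. -/
theorem EBMLine.of_compression {Z Y U E : Matrix ι ι ℂ} {φ : ι → ℂ} (hZ : Z.PosSemidef)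
    (hU : U ∈ Matrix.unitaryGroup ι ℂ) (hE : IsStarProjection E) (hφ : E *ᵥ (U *ᵥ φ) = U *ᵥ φ)
    (h : (Y - Uᴴ * E * Z * E * U).PosDef) : EBMLine (prob Z (U *ᵥ φ)) (prob Y φ) := by
  have hEh : Eᴴ = E := hE.isSelfAdjoint
  have hEE : E * E = E := hE.isIdempotentElem
  have hUU : U * Uᴴ = 1 := Matrix.mem_unitaryGroup_iff.1 hU
  have hUU' : Uᴴ * U = 1 := Matrix.mem_unitaryGroup_iff'.1 hU
  have hEU : (Uᴴ * E)ᴴ * (Uᴴ * E) = E := by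
    rw [Matrix.conjTranspose_mul, Matrix.conjTranspose_conjTranspose, hEh, Matrix.mul_assoc,
      ← Matrix.mul_assoc U, hUU, Matrix.one_mul, hEE]
  let W : Matrix (ι ⊕ ι) ι ℂ := Matrix.fromRows (Uᴴ * E) (1 - E)
  have hW : Wᴴ * W = 1 := by
    have hisom := conjTranspose_fromRows_mul_fromRows_one_sub (R := Uᴴ * E)
      (hEU.symm ▸ hE.isIdempotentElem)
    rwa [hEU] at hisom
  have hWφ : W *ᵥ (U *ᵥ φ) = Sum.elim φ 0 := by
    rw [Matrix.fromRows_mulVec, ← Matrix.mulVec_mulVec, hφ, Matrix.sub_mulVec, hφ,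
      Matrix.one_mulVec, sub_self, Matrix.mulVec_mulVec, hUU', Matrix.one_mulVec]
  obtain ⟨c, hc⟩ := exists_fromBlocks_sub_posSemidef hZ.isHermitian (R := Uᴴ * E) (1 - E) (by
    rwa [Matrix.conjTranspose_mul, Matrix.conjTranspose_conjTranspose, hEh, ← Matrix.mul_assoc])
  have hline := EBMLine.of_posSemidef (hZ.mul_mul_conjTranspose_same W) hc (W *ᵥ (U *ᵥ φ))
  rwa [prob_conj hW, hWφ, prob_fromBlocks_elim_zero] at hline

end Dilation

section Vectors

variable {ι κ : Type*} [Fintype ι] [Fintype κ]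

theorem braket_mulVec_mulVec (X : Matrix κ ι ℂ) (Z : Matrix κ κ ℂ) (v : ι → ℂ) :
    braket (X *ᵥ v) (Z *ᵥ (X *ᵥ v)) = braket v ((Xᴴ * Z * X) *ᵥ v) := by
  rw [braket, braket, star_mulVec_dotProduct, Matrix.mulVec_mulVec, Matrix.mulVec_mulVec,
    Matrix.mul_assoc]

theorem braket_self (v : ι → ℂ) : braket v v = (sqNorm v : ℂ) := by
  simp [braket, sqNorm, dotProduct, Complex.conj_mul']

theorem braket_comp_equiv (e : κ ≃ ι) (v w : ι → ℂ) : braket (v ∘ e) (w ∘ e) = braket v w :=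
  comp_equiv_dotProduct_comp_equiv (star v) w e

theorem sqNorm_eq_re_braket (v : ι → ℂ) : sqNorm v = (braket v v).re := by
  rw [braket_self, Complex.ofReal_re]

theorem sqNorm_comp_equiv (e : κ ≃ ι) (v : ι → ℂ) : sqNorm (v ∘ e) = sqNorm v := by
  rw [sqNorm_eq_re_braket, braket_comp_equiv, ← sqNorm_eq_re_braket]

theorem sqNorm_single_one [DecidableEq ι] (k : ι) : sqNorm (Pi.single k 1 : ι → ℂ) = 1 := by
  rw [sqNorm, Finset.sum_eq_single_of_mem k (Finset.mem_univ k)]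
  · rw [Pi.single_eq_same, norm_one, one_pow]
  · intro i _ hi
    rw [Pi.single_eq_of_ne hi, norm_zero, zero_pow two_ne_zero]

theorem exists_sqNorm_eq_one (ι : Type*) [Fintype ι] [Nonempty ι] : ∃ v : ι → ℂ, sqNorm v = 1 := by
  classical
  exact ⟨Pi.single (Classical.arbitrary ι) 1, sqNorm_single_one _⟩

theorem nonempty_of_sqNorm_eq_one {v : ι → ℂ} (h : sqNorm v = 1) : Nonempty ι := by
  by_contra hι
  rw [not_nonempty_iff] at hι
  simp [sqNorm] at h

theorem re_braket_mulVec_le_sqNorm [DecidableEq ι] {X : Matrix ι ι ℂ} (hX : (1 - X).PosSemidef)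
    (v : ι → ℂ) : (braket v (X *ᵥ v)).re ≤ sqNorm v := by
  have h : 0 ≤ (star v ⬝ᵥ (1 - X) *ᵥ v).re := hX.re_dotProduct_nonneg v
  rwa [Matrix.sub_mulVec, dotProduct_sub, Matrix.one_mulVec, Complex.sub_re, sub_nonneg, ← braket,
    ← braket, ← sqNorm_eq_re_braket] at h

theorem sqNorm_mulVec (X : Matrix κ ι ℂ) (v : ι → ℂ) :
    sqNorm (X *ᵥ v) = (braket v ((Xᴴ * X) *ᵥ v)).re := by
  rw [sqNorm_eq_re_braket, braket, star_mulVec_dotProduct, Matrix.mulVec_mulVec, braket]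

theorem sqNorm_mulVec_of_mem_unitaryGroup [DecidableEq ι] {W : Matrix ι ι ℂ}
    (hW : W ∈ Matrix.unitaryGroup ι ℂ) (v : ι → ℂ) : sqNorm (W *ᵥ v) = sqNorm v := by
  rw [sqNorm_mulVec, ← Matrix.star_eq_conjTranspose, Matrix.mem_unitaryGroup_iff'.1 hW,
    Matrix.one_mulVec, ← sqNorm_eq_re_braket]

theorem sqNorm_mulVec_le_of_isStarProjection {E : Matrix ι ι ℂ}
    (hE : IsStarProjection E) (v : ι → ℂ) : sqNorm (E *ᵥ v) ≤ sqNorm v := by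
  classical
  rw [sqNorm_mulVec, ← Matrix.star_eq_conjTranspose, hE.isSelfAdjoint.star_eq,
    hE.isIdempotentElem.eq]
  open scoped MatrixOrder in
  exact re_braket_mulVec_le_sqNorm (Matrix.nonneg_iff_posSemidef.1 hE.one_sub.nonneg) v

theorem sqNorm_mul_mulVec_le [DecidableEq ι] {E U : Matrix ι ι ℂ} (hE : IsStarProjection E)
    (hU : U ∈ Matrix.unitaryGroup ι ℂ) (v : ι → ℂ) : sqNorm ((E * U) *ᵥ v) ≤ sqNorm v := by
  rw [← Matrix.mulVec_mulVec, ← sqNorm_mulVec_of_mem_unitaryGroup hU v]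
  exact sqNorm_mulVec_le_of_isStarProjection hE _

theorem submatrix_equiv_mem_unitaryGroup [DecidableEq ι] [DecidableEq κ] (e : κ ≃ ι)
    {W : Matrix ι ι ℂ} (hW : W ∈ Matrix.unitaryGroup ι ℂ) :
    W.submatrix e e ∈ Matrix.unitaryGroup κ ℂ := by
  rw [Matrix.mem_unitaryGroup_iff, Matrix.star_eq_conjTranspose, Matrix.conjTranspose_submatrix,
    Matrix.submatrix_mul_equiv, ← Matrix.star_eq_conjTranspose, Matrix.mem_unitaryGroup_iff.1 hW,
    Matrix.submatrix_one_equiv]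

theorem kronecker_mulVec_tensorVec (X : Matrix ι ι ℂ) (Y : Matrix κ κ ℂ) (v : ι → ℂ) (w : κ → ℂ) :
    (X ⊗ₖ Y) *ᵥ tensorVec v w = tensorVec (X *ᵥ v) (Y *ᵥ w) := by
  ext ⟨i, j⟩
  simp only [Matrix.mulVec, dotProduct, tensorVec, Matrix.kroneckerMap_apply,
    Fintype.sum_prod_type, Finset.sum_mul_sum, mul_mul_mul_comm]

theorem braket_tensorVec (v v' : ι → ℂ) (w w' : κ → ℂ) :
    braket (tensorVec v w) (tensorVec v' w') = braket v v' * braket w w' := by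
  simp only [braket, dotProduct, tensorVec, Fintype.sum_prod_type, Finset.sum_mul_sum,
    Pi.star_apply, star_mul', mul_mul_mul_comm]

theorem sqNorm_tensorVec (v : ι → ℂ) (w : κ → ℂ) :
    sqNorm (tensorVec v w) = sqNorm v * sqNorm w := by
  rw [← Complex.ofReal_inj, Complex.ofReal_mul, ← braket_self, ← braket_self, ← braket_self,
    braket_tensorVec]

theorem kronecker_one_mulVec_vec_transpose [DecidableEq κ] (Z : Matrix ι ι ℂ) (Φ : Matrix ι κ ℂ) :
    (Z ⊗ₖ (1 : Matrix κ κ ℂ)) *ᵥ Φᵀ.vec = (Z * Φ)ᵀ.vec := by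
  rw [Matrix.kronecker_mulVec_vec, Matrix.one_mul, Matrix.transpose_mul]

theorem one_kronecker_mulVec_vec_transpose [DecidableEq ι] (W : Matrix κ κ ℂ) (Φ : Matrix ι κ ℂ) :
    ((1 : Matrix ι ι ℂ) ⊗ₖ W) *ᵥ Φᵀ.vec = (Φ * Wᵀ)ᵀ.vec := by
  rw [Matrix.kronecker_mulVec_vec, Matrix.transpose_one, Matrix.mul_one, Matrix.transpose_mul,
    Matrix.transpose_transpose]

theorem braket_kronecker_one_mulVec_vec_transpose [DecidableEq κ] (Z : Matrix ι ι ℂ)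
    (Φ : Matrix ι κ ℂ) :
    braket Φᵀ.vec ((Z ⊗ₖ (1 : Matrix κ κ ℂ)) *ᵥ Φᵀ.vec) = (Z * (Φ * Φᴴ)).trace := by
  rw [kronecker_one_mulVec_vec_transpose, braket, Matrix.star_vec_dotProduct_vec,
    Matrix.conjTranspose_transpose_eq_transpose_conjTranspose, ← Matrix.transpose_mul,
    Matrix.trace_transpose, Matrix.mul_assoc]

end Vectors

section TensorFactors

variable {A M B : Type*}

theorem onAM_sub [DecidableEq B] (X Y : Matrix (A × M) (A × M) ℂ) :
    (onAM (X - Y) : Matrix (A × M × B) (A × M × B) ℂ) = onAM X - onAM Y := by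
  ext
  simp [onAM, sub_mul]

theorem onMB_sub [DecidableEq A] (X Y : Matrix (M × B) (M × B) ℂ) :
    (onMB (X - Y) : Matrix (A × M × B) (A × M × B) ℂ) = onMB X - onMB Y := by
  ext
  simp [onMB, mul_sub]

theorem onAM_conjTranspose [DecidableEq B] (X : Matrix (A × M) (A × M) ℂ) :
    (onAM X : Matrix (A × M × B) (A × M × B) ℂ)ᴴ = onAM Xᴴ := by
  simp [onAM, Matrix.conjTranspose_kronecker]

theorem onMB_conjTranspose [DecidableEq A] (X : Matrix (M × B) (M × B) ℂ) :
    (onMB X : Matrix (A × M × B) (A × M × B) ℂ)ᴴ = onMB Xᴴ := by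
  simp [onMB, Matrix.conjTranspose_kronecker]

theorem onMB_one_kronecker [DecidableEq A] [DecidableEq M] (Y : Matrix B B ℂ) :
    (onMB ((1 : Matrix M M ℂ) ⊗ₖ Y) : Matrix (A × M × B) (A × M × B) ℂ) = onAB 1 Y :=
  rfl

section DecidableEq

variable [DecidableEq A] [DecidableEq M] [DecidableEq B]

theorem onAM_one : (onAM 1 : Matrix (A × M × B) (A × M × B) ℂ) = 1 := by
  simp [onAM]

theorem onMB_one : (onMB 1 : Matrix (A × M × B) (A × M × B) ℂ) = 1 := by
  simp [onMB]

theorem onAB_one_one : (onAB 1 1 : Matrix (A × M × B) (A × M × B) ℂ) = 1 := by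
  rw [onAB, Matrix.one_kronecker_one, Matrix.one_kronecker_one]

end DecidableEq

theorem onAB_sub_left [DecidableEq M] (X X' : Matrix A A ℂ) (Y : Matrix B B ℂ) :
    (onAB (X - X') Y : Matrix (A × M × B) (A × M × B) ℂ) = onAB X Y - onAB X' Y := by
  ext
  simp [onAB, sub_mul]

theorem onAB_sub_right [DecidableEq M] (X : Matrix A A ℂ) (Y Y' : Matrix B B ℂ) :
    (onAB X (Y - Y') : Matrix (A × M × B) (A × M × B) ℂ) = onAB X Y - onAB X Y' := by
  ext
  simp [onAB, mul_sub]

theorem onAM_kronecker_one [DecidableEq M] [DecidableEq B] (X : Matrix A A ℂ) :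
    (onAM (X ⊗ₖ (1 : Matrix M M ℂ)) : Matrix (A × M × B) (A × M × B) ℂ) = onAB X 1 := by
  rw [onAM, onAB, Matrix.kronecker_assoc]

theorem tensorVec_tensorVec (a : A → ℂ) (m : M → ℂ) (b : B → ℂ) :
    tensorVec a (tensorVec m b) = tensorVec (tensorVec a m) b ∘ (Equiv.prodAssoc A M B).symm :=
  funext fun x => (mul_assoc (a x.1) (m x.2.1) (b x.2.2)).symm

section Finite

variable [Finite A] [Finite M] [Finite B]

theorem onAB_posSemidef [DecidableEq M] {X : Matrix A A ℂ} {Y : Matrix B B ℂ}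
    (hX : X.PosSemidef) (hY : Y.PosSemidef) :
    (onAB X Y : Matrix (A × M × B) (A × M × B) ℂ).PosSemidef :=
  hX.kronecker (Matrix.PosSemidef.one.kronecker hY)

theorem onAM_posDef [DecidableEq B] {X : Matrix (A × M) (A × M) ℂ} (hX : X.PosDef) :
    (onAM X : Matrix (A × M × B) (A × M × B) ℂ).PosDef :=
  (hX.kronecker Matrix.PosDef.one).submatrix (Equiv.injective _)

theorem onMB_posDef [DecidableEq A] {X : Matrix (M × B) (M × B) ℂ} (hX : X.PosDef) :
    (onMB X : Matrix (A × M × B) (A × M × B) ℂ).PosDef :=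
  Matrix.PosDef.one.kronecker hX

end Finite

variable [Fintype A] [Fintype M] [Fintype B]

theorem onAM_mul [DecidableEq B] (X Y : Matrix (A × M) (A × M) ℂ) :
    (onAM (X * Y) : Matrix (A × M × B) (A × M × B) ℂ) = onAM X * onAM Y := by
  simp only [onAM, Matrix.reindex_apply, Matrix.submatrix_mul_equiv, ← Matrix.mul_kronecker_mul,
    Matrix.one_mul]

theorem onMB_mul [DecidableEq A] (X Y : Matrix (M × B) (M × B) ℂ) :
    (onMB (X * Y) : Matrix (A × M × B) (A × M × B) ℂ) = onMB X * onMB Y := by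
  simp only [onMB, ← Matrix.mul_kronecker_mul, Matrix.one_mul]

theorem onAB_mul [DecidableEq M] (X X' : Matrix A A ℂ) (Y Y' : Matrix B B ℂ) :
    (onAB (X * X') (Y * Y') : Matrix (A × M × B) (A × M × B) ℂ) = onAB X Y * onAB X' Y' := by
  simp only [onAB, ← Matrix.mul_kronecker_mul, Matrix.one_mul]

theorem onAB_mulVec_tensorVec [DecidableEq M] (X : Matrix A A ℂ) (Y : Matrix B B ℂ) (a : A → ℂ)
    (m : M → ℂ) (b : B → ℂ) :
    onAB X Y *ᵥ tensorVec a (tensorVec m b) = tensorVec (X *ᵥ a) (tensorVec m (Y *ᵥ b)) := by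
  rw [onAB, kronecker_mulVec_tensorVec, kronecker_mulVec_tensorVec, Matrix.one_mulVec]

theorem onMB_mulVec_tensorVec [DecidableEq A] (W : Matrix (M × B) (M × B) ℂ) (a : A → ℂ)
    (ω : M × B → ℂ) : onMB W *ᵥ tensorVec a ω = tensorVec a (W *ᵥ ω) := by
  rw [onMB, kronecker_mulVec_tensorVec, Matrix.one_mulVec]

theorem onAM_mulVec_comp_prodAssoc_symm [DecidableEq B] (X : Matrix (A × M) (A × M) ℂ)
    (v : (A × M) × B → ℂ) :
    onAM X *ᵥ (v ∘ (Equiv.prodAssoc A M B).symm) =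
      ((X ⊗ₖ (1 : Matrix B B ℂ)) *ᵥ v) ∘ (Equiv.prodAssoc A M B).symm := by
  rw [onAM, Matrix.reindex_apply, Matrix.submatrix_mulVec_equiv, Equiv.symm_symm,
    Function.comp_assoc, Equiv.symm_comp_self, Function.comp_id]

theorem braket_onAB_one_mulVec_vec_transpose [DecidableEq M] [DecidableEq B] (Z : Matrix A A ℂ)
    (Φ : Matrix A (M × B) ℂ) :
    braket Φᵀ.vec (onAB Z 1 *ᵥ Φᵀ.vec) = (Z * (Φ * Φᴴ)).trace := by
  rw [onAB, Matrix.one_kronecker_one, braket_kronecker_one_mulVec_vec_transpose]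

theorem braket_onAM_mulVec_vec_transpose [DecidableEq B] (Q : Matrix (A × M) (A × M) ℂ)
    (R : Matrix (A × M) B ℂ) :
    braket (Rᵀ.vec ∘ (Equiv.prodAssoc A M B).symm)
      (onAM Q *ᵥ (Rᵀ.vec ∘ (Equiv.prodAssoc A M B).symm)) = (Q * (R * Rᴴ)).trace := by
  rw [onAM_mulVec_comp_prodAssoc_symm, braket_comp_equiv,
    braket_kronecker_one_mulVec_vec_transpose]

theorem braket_onAM_mulVec_tensorVec [DecidableEq B] (Q X : Matrix (A × M) (A × M) ℂ)
    (a : A → ℂ) (m : M → ℂ) (b : B → ℂ) :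
    braket (onAM X *ᵥ tensorVec a (tensorVec m b))
      (onAM Q *ᵥ (onAM X *ᵥ tensorVec a (tensorVec m b))) =
      braket (X *ᵥ tensorVec a m) (Q *ᵥ (X *ᵥ tensorVec a m)) * sqNorm b := by
  rw [tensorVec_tensorVec, onAM_mulVec_comp_prodAssoc_symm, onAM_mulVec_comp_prodAssoc_symm,
    braket_comp_equiv, kronecker_mulVec_tensorVec, kronecker_mulVec_tensorVec, braket_tensorVec,
    Matrix.one_mulVec, Matrix.one_mulVec, braket_self b]

theorem isStarProjection_onAM [DecidableEq B] {E : Matrix (A × M) (A × M) ℂ}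
    (hE : IsStarProjection E) :
    IsStarProjection (onAM E : Matrix (A × M × B) (A × M × B) ℂ) where
  isIdempotentElem := by rw [IsIdempotentElem, ← onAM_mul, hE.isIdempotentElem.eq]
  isSelfAdjoint := by
    rw [IsSelfAdjoint, Matrix.star_eq_conjTranspose, onAM_conjTranspose,
      ← Matrix.star_eq_conjTranspose, hE.isSelfAdjoint.star_eq]

theorem isStarProjection_onMB [DecidableEq A] {E : Matrix (M × B) (M × B) ℂ}
    (hE : IsStarProjection E) :
    IsStarProjection (onMB E : Matrix (A × M × B) (A × M × B) ℂ) where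
  isIdempotentElem := by rw [IsIdempotentElem, ← onMB_mul, hE.isIdempotentElem.eq]
  isSelfAdjoint := by
    rw [IsSelfAdjoint, Matrix.star_eq_conjTranspose, onMB_conjTranspose,
      ← Matrix.star_eq_conjTranspose, hE.isSelfAdjoint.star_eq]

variable [DecidableEq A] [DecidableEq M] [DecidableEq B]

theorem onAM_mem_unitaryGroup {U : Matrix (A × M) (A × M) ℂ}
    (hU : U ∈ Matrix.unitaryGroup (A × M) ℂ) :
    (onAM U : Matrix (A × M × B) (A × M × B) ℂ) ∈ Matrix.unitaryGroup (A × M × B) ℂ := by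
  rw [Matrix.mem_unitaryGroup_iff, Matrix.star_eq_conjTranspose, onAM_conjTranspose, ← onAM_mul,
    ← Matrix.star_eq_conjTranspose, Matrix.mem_unitaryGroup_iff.1 hU, onAM_one]

theorem onMB_mem_unitaryGroup {U : Matrix (M × B) (M × B) ℂ}
    (hU : U ∈ Matrix.unitaryGroup (M × B) ℂ) :
    (onMB U : Matrix (A × M × B) (A × M × B) ℂ) ∈ Matrix.unitaryGroup (A × M × B) ℂ := by
  rw [Matrix.mem_unitaryGroup_iff, Matrix.star_eq_conjTranspose, onMB_conjTranspose, ← onMB_mul,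
    ← Matrix.star_eq_conjTranspose, Matrix.mem_unitaryGroup_iff.1 hU, onMB_one]

theorem onAM_mul_onAB_one (X : Matrix (A × M) (A × M) ℂ) (Y : Matrix B B ℂ) :
    (onAM X : Matrix (A × M × B) (A × M × B) ℂ) * onAB 1 Y = onAB 1 Y * onAM X := by
  have h : (onAB 1 Y : Matrix (A × M × B) (A × M × B) ℂ) =
      Matrix.reindex (Equiv.prodAssoc A M B) (Equiv.prodAssoc A M B)
        ((1 : Matrix (A × M) (A × M) ℂ) ⊗ₖ Y) := by
    rw [onAB, ← Matrix.kronecker_assoc, Matrix.one_kronecker_one]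
  simp only [h, onAM, Matrix.reindex_apply, Matrix.submatrix_mul_equiv,
    ← Matrix.mul_kronecker_mul, Matrix.one_mul, Matrix.mul_one]

theorem onMB_mul_onAB_one (X : Matrix (M × B) (M × B) ℂ) (Y : Matrix A A ℂ) :
    (onMB X : Matrix (A × M × B) (A × M × B) ℂ) * onAB Y 1 = onAB Y 1 * onMB X := by
  simp only [onMB, onAB, Matrix.one_kronecker_one, ← Matrix.mul_kronecker_mul, Matrix.one_mul,
    Matrix.mul_one]

end TensorFactors

section Chain

variable {H M : Type*} [Fintype H] [Fintype M]

theorem eq_of_forall_re_trace_mul_eq {X Y : Matrix H M ℂ}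
    (h : ∀ Z : Matrix M H ℂ, (Z * X).trace.re = (Z * Y).trace.re) : X = Y := by
  have hre : ((X - Y)ᴴ * (X - Y)).trace.re = 0 := by
    rw [Matrix.mul_sub, Matrix.trace_sub, Complex.sub_re, h, sub_self]
  have him := (Complex.nonneg_iff.1
    (Matrix.posSemidef_conjTranspose_mul_self (X - Y)).trace_nonneg).2
  exact sub_eq_zero.1 (Matrix.trace_conjTranspose_mul_self_eq_zero_iff.1
    (Complex.ext hre him.symm))

theorem exists_eq_mul_conjTranspose_of_posSemidef {ρ : Matrix H H ℂ}
    (hρ : ρ.PosSemidef) : ∃ R : Matrix H (Fin (Fintype.card H)) ℂ, ρ = R * Rᴴ := by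
  classical
  open scoped MatrixOrder in
  obtain ⟨R, hR⟩ := CStarAlgebra.nonneg_iff_eq_mul_star_self.mp hρ.nonneg
  refine ⟨R.submatrix id (Fintype.equivFin H).symm, ?_⟩
  rw [Matrix.conjTranspose_submatrix, Matrix.submatrix_mul_equiv, Matrix.submatrix_id_id]
  exact hR

/-- The state after `j` rounds in which the adversary applies `W i` and then the honest player
applies `K i`, for `i = 0, …, j - 1`. -/
noncomputable def chainRun [DecidableEq H] {d : ℕ} (K : ℕ → Matrix (H × M) (H × M) ℂ)
    (W : ℕ → Matrix (M × Fin d) (M × Fin d) ℂ) (φ : H × M × Fin d → ℂ) :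
    ℕ → (H × M × Fin d → ℂ)
  | 0 => φ
  | j + 1 => onAM (K j) *ᵥ (onMB (W j) *ᵥ chainRun K W φ j)

theorem chainRun_succ_eq_chainRun [DecidableEq H] {d : ℕ} (K : ℕ → Matrix (H × M) (H × M) ℂ)
    (W : ℕ → Matrix (M × Fin d) (M × Fin d) ℂ) (φ : H × M × Fin d → ℂ) (j : ℕ) :
    chainRun K W φ (j + 1) = chainRun (fun j => K (j + 1)) (fun j => W (j + 1))
      (onAM (K 0) *ᵥ (onMB (W 0) *ᵥ φ)) j := by
  induction j with
  | zero => rfl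
  | succ j ih => rw [chainRun, ih, chainRun]

variable [DecidableEq M]

/-- Dual feasibility with strict inequalities: `Z 0, …, Z r` bounds the value of `F` against an
adversary who acts on `M` and on a workspace before each of the operators `K 0, …, K (r - 1)` of the
honest player on `H ⊗ M`. -/
structure StrictChain (K : ℕ → Matrix (H × M) (H × M) ℂ) (F : Matrix H H ℂ) (r : ℕ)
    (Z : ℕ → Matrix H H ℂ) : Prop where
  last : Z r = F
  step : ∀ j < r,
    (Z j ⊗ₖ (1 : Matrix M M ℂ) - (K j)ᴴ * (Z (j + 1) ⊗ₖ (1 : Matrix M M ℂ)) * K j).PosDef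

theorem posSemidef_of_kronecker_one {H M : Type*} [DecidableEq M] [Nonempty M] {Z : Matrix H H ℂ}
    (h : (Z ⊗ₖ (1 : Matrix M M ℂ)).PosSemidef) : Z.PosSemidef := by
  have m := Classical.arbitrary M
  convert h.submatrix (fun x => (x, m)) using 1
  ext i j
  simp

theorem posSemidef_conj_kronecker_one (K : Matrix (H × M) (H × M) ℂ) {Z : Matrix H H ℂ}
    (hZ : Z.PosSemidef) : (Kᴴ * (Z ⊗ₖ (1 : Matrix M M ℂ)) * K).PosSemidef :=
  (hZ.kronecker Matrix.PosSemidef.one).conjTranspose_mul_mul_same K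

variable {K : ℕ → Matrix (H × M) (H × M) ℂ} {F : Matrix H H ℂ} {r : ℕ} {Z : ℕ → Matrix H H ℂ}

theorem StrictChain.zero (K : ℕ → Matrix (H × M) (H × M) ℂ) (F : Matrix H H ℂ) :
    StrictChain K F 0 fun _ => F where
  last := rfl
  step _ hj := absurd hj (Nat.not_lt_zero _)

theorem StrictChain.cons (hZ : StrictChain (fun j => K (j + 1)) F r Z) {Z' : Matrix H H ℂ}
    (h : (Z' ⊗ₖ (1 : Matrix M M ℂ) - (K 0)ᴴ * (Z 0 ⊗ₖ (1 : Matrix M M ℂ)) * K 0).PosDef) :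
    StrictChain K F (r + 1) (fun j => Nat.casesOn j Z' Z) where
  last := hZ.last
  step
    | 0, _ => h
    | j + 1, hj => hZ.step j (Nat.lt_of_succ_lt_succ hj)

theorem StrictChain.posSemidef [Nonempty M] (hZ : StrictChain K F r Z) (hF : F.PosSemidef) {j : ℕ}
    (hj : j ≤ r) : (Z j).PosSemidef := by
  induction hj using Nat.decreasingInduction with
  | self => exact hZ.last ▸ hF
  | of_succ j hj ih =>
    have h := (hZ.step j hj).posSemidef.add (posSemidef_conj_kronecker_one (K j) ih)
    rw [sub_add_cancel] at h
    exact posSemidef_of_kronecker_one h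

theorem exists_strictChain [Nonempty M] (hF : F.PosSemidef) (r : ℕ)
    (K : ℕ → Matrix (H × M) (H × M) ℂ) : ∃ Z, StrictChain K F r Z := by
  classical
  induction r generalizing K with
  | zero => exact ⟨_, .zero K F⟩
  | succ r ih =>
    obtain ⟨Z, hZ⟩ := ih fun j => K (j + 1)
    obtain ⟨c, hc⟩ := exists_smul_one_sub_posDef
      (posSemidef_conj_kronecker_one (K 0) (hZ.posSemidef hF (Nat.zero_le r))).isHermitian
    refine ⟨_, hZ.cons (Z' := c • 1) ?_⟩
    rwa [Matrix.smul_kronecker, Matrix.one_kronecker_one]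

theorem convex_setOf_strictChain (K : ℕ → Matrix (H × M) (H × M) ℂ) (F : Matrix H H ℂ) (r : ℕ) :
    Convex ℝ {Z | StrictChain K F r Z} := by
  rw [convex_iff_forall_pos]
  intro Z (hZ : StrictChain K F r Z) Z' (hZ' : StrictChain K F r Z') a b ha hb hab
  refine ⟨?_, fun j hj => ?_⟩
  · rw [Pi.add_apply, Pi.smul_apply, Pi.smul_apply, hZ.last, hZ'.last, ← add_smul, hab, one_smul]
  · convert ((hZ.step j hj).smul ha).add ((hZ'.step j hj).smul hb) using 1
    simp only [Pi.add_apply, Pi.smul_apply, Matrix.add_kronecker, Matrix.smul_kronecker,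
      Matrix.mul_add, Matrix.add_mul, Matrix.mul_smul, Matrix.smul_mul, smul_sub]
    abel

variable [DecidableEq H]

/-- Both `φ` and a purification of `ρ` purify the same state of `H`, so they differ by a unitary on
the rest. -/
theorem exists_mem_unitaryGroup_braket_onAM_eq_trace
    (φ : H × M × Fin (Fintype.card (H × M)) → ℂ) {ρ : Matrix (H × M) (H × M) ℂ}
    (hρ : ρ.PosSemidef)
    (hφ : ∀ Z : Matrix H H ℂ, (ρ * (Z ⊗ₖ (1 : Matrix M M ℂ))).trace.re =
      (braket φ (onAB Z 1 *ᵥ φ)).re) :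
    ∃ W ∈ Matrix.unitaryGroup (M × Fin (Fintype.card (H × M))) ℂ, ∀ Q,
      braket (onMB W *ᵥ φ) (onAM Q *ᵥ (onMB W *ᵥ φ)) = (ρ * Q).trace := by
  let Φ : Matrix H (M × Fin (Fintype.card (H × M))) ℂ := Matrix.of fun a n => φ (a, n)
  have hφΦ : φ = Φᵀ.vec := rfl
  obtain ⟨R, rfl⟩ := exists_eq_mul_conjTranspose_of_posSemidef hρ
  let Χ : Matrix H (M × Fin (Fintype.card (H × M))) ℂ := Matrix.of fun a n => R (a, n.1) n.2
  have hΧR : Χᵀ.vec = Rᵀ.vec ∘ (Equiv.prodAssoc _ _ _).symm := rfl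
  have hΦΧ : Φ * Φᴴ = Χ * Χᴴ := eq_of_forall_re_trace_mul_eq fun Z => by
    rw [← braket_onAB_one_mulVec_vec_transpose, ← braket_onAB_one_mulVec_vec_transpose, ← hφΦ,
      ← hφ, ← onAM_kronecker_one, hΧR, braket_onAM_mulVec_vec_transpose, Matrix.trace_mul_comm]
  obtain ⟨W, hW, hΧW⟩ := exists_mem_unitaryGroup_eq_mul hΦΧ
  refine ⟨Wᵀ, Matrix.transpose_mem_unitaryGroup_iff.2 hW, fun Q => ?_⟩
  rw [hφΦ, onMB, one_kronecker_mulVec_vec_transpose, Matrix.transpose_transpose, ← hΧW, hΧR,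
    braket_onAM_mulVec_vec_transpose, Matrix.trace_mul_comm]

/-- The minimax step: `W` is chosen before `Z`. -/
theorem exists_mem_unitaryGroup_forall_le_braket (K : Matrix (H × M) (H × M) ℂ)
    {S : Set (Matrix H H ℂ)} (hS : Convex ℝ S) (hne : S.Nonempty) (hherm : ∀ Z ∈ S, Z.IsHermitian)
    (φ : H × M × Fin (Fintype.card (H × M)) → ℂ) {t : ℝ}
    (h : ∀ Z ∈ S, ∀ Z' : Matrix H H ℂ,
      (Z' ⊗ₖ (1 : Matrix M M ℂ) - Kᴴ * (Z ⊗ₖ (1 : Matrix M M ℂ)) * K).PosDef →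
      t ≤ (braket φ (onAB Z' 1 *ᵥ φ)).re) :
    ∃ W ∈ Matrix.unitaryGroup (M × Fin (Fintype.card (H × M))) ℂ, ∀ Z ∈ S,
      t ≤ (braket (onAM K *ᵥ (onMB W *ᵥ φ)) (onAB Z 1 *ᵥ (onAM K *ᵥ (onMB W *ᵥ φ)))).re := by
  let Φ : Matrix H (M × Fin (Fintype.card (H × M))) ℂ := Matrix.of fun a n => φ (a, n)
  have hΦ (Z : Matrix H H ℂ) : (Z * (Φ * Φᴴ)).trace = braket φ (onAB Z 1 *ᵥ φ) :=
    (braket_onAB_one_mulVec_vec_transpose Z Φ).symm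
  let k : Matrix H H ℂ →ₗ[ℝ] Matrix (H × M) (H × M) ℂ :=
    LinearMap.mulRight ℝ K ∘ₗ LinearMap.mulLeft ℝ Kᴴ ∘ₗ kroneckerOne H M
  have hherm' : ∀ Q ∈ k '' S, Q.IsHermitian := by
    rintro _ ⟨Z, hZ, rfl⟩
    refine Matrix.isHermitian_conjTranspose_mul_mul _ ?_
    rw [Matrix.IsHermitian, kroneckerOne, LinearMap.coe_mk, AddHom.coe_mk,
      Matrix.conjTranspose_kronecker, (hherm Z hZ).eq, Matrix.conjTranspose_one]
  obtain ⟨ρ, hρ, hρΦ, hρS⟩ := exists_posSemidef_marginal_of_forall_posDef (hS.linear_image k)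
    (hne.image k) hherm' (Matrix.posSemidef_self_mul_conjTranspose Φ).isHermitian (t := t) (by
      rintro _ ⟨Z, hZ, rfl⟩ Z' hZ'
      rw [hΦ]
      exact h Z hZ Z' hZ')
  obtain ⟨W, hW, hWρ⟩ := exists_mem_unitaryGroup_braket_onAM_eq_trace φ hρ fun Z => by
    rw [hρΦ, hΦ]
  refine ⟨W, hW, fun Z hZ => ?_⟩
  rw [← onAM_kronecker_one, braket_mulVec_mulVec, onAM_conjTranspose, ← onAM_mul, ← onAM_mul, hWρ]
  exact hρS _ ⟨Z, hZ, rfl⟩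

theorem exists_mem_unitaryGroup_le_chainRun [Nonempty M] (hF : F.PosSemidef) {t : ℝ} (r : ℕ)
    (K : ℕ → Matrix (H × M) (H × M) ℂ) (φ : H × M × Fin (Fintype.card (H × M)) → ℂ)
    (h : ∀ Z, StrictChain K F r Z → t ≤ (braket φ (onAB (Z 0) 1 *ᵥ φ)).re) :
    ∃ W : ℕ → Matrix (M × Fin (Fintype.card (H × M))) (M × Fin (Fintype.card (H × M))) ℂ,
      (∀ j, W j ∈ Matrix.unitaryGroup (M × Fin (Fintype.card (H × M))) ℂ) ∧
      t ≤ (braket (chainRun K W φ r) (onAB F 1 *ᵥ chainRun K W φ r)).re := by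
  induction r generalizing K φ with
  | zero =>
    have hle := h _ (StrictChain.zero K F)
    exact ⟨fun _ => 1, fun _ => one_mem _, hle⟩
  | succ r ih =>
    let K' := fun j => K (j + 1)
    obtain ⟨Z₁, hZ₁⟩ := exists_strictChain hF r K'
    let S : Set (Matrix H H ℂ) := (fun Z => Z 0) '' {Z | StrictChain K' F r Z}
    have hconv : Convex ℝ S :=
      (convex_setOf_strictChain K' F r).linear_image (LinearMap.proj (R := ℝ) 0)
    have hherm : ∀ Z ∈ S, Z.IsHermitian := by
      rintro _ ⟨Z, hZ, rfl⟩
      exact (StrictChain.posSemidef hZ hF (Nat.zero_le r)).isHermitian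
    have hstep : ∀ Z ∈ S, ∀ Z' : Matrix H H ℂ,
        (Z' ⊗ₖ (1 : Matrix M M ℂ) - (K 0)ᴴ * (Z ⊗ₖ (1 : Matrix M M ℂ)) * K 0).PosDef →
        t ≤ (braket φ (onAB Z' 1 *ᵥ φ)).re := by
      rintro _ ⟨Z, hZ, rfl⟩ Z' hZ'
      have hcons := h _ (StrictChain.cons hZ hZ')
      exact hcons
    obtain ⟨W₀, hW₀, hle₀⟩ := exists_mem_unitaryGroup_forall_le_braket (K 0) hconv
      ⟨Z₁ 0, Z₁, hZ₁, rfl⟩ hherm φ hstep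
    obtain ⟨W, hW, hle⟩ := ih K' (onAM (K 0) *ᵥ (onMB W₀ *ᵥ φ)) fun Z hZ =>
      hle₀ (Z 0) ⟨Z, hZ, rfl⟩
    refine ⟨fun j => Nat.casesOn j W₀ W, Nat.rec hW₀ fun j _ => hW j, ?_⟩
    rwa [chainRun_succ_eq_chainRun]

theorem exists_strictChain_of_forall_chainRun_lt [Nonempty M] (hF : F.PosSemidef) {t : ℝ} (r : ℕ)
    (K : ℕ → Matrix (H × M) (H × M) ℂ) (φ : H × M × Fin (Fintype.card (H × M)) → ℂ)
    (h : ∀ W : ℕ → Matrix (M × Fin (Fintype.card (H × M))) (M × Fin (Fintype.card (H × M))) ℂ,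
      (∀ j, W j ∈ Matrix.unitaryGroup (M × Fin (Fintype.card (H × M))) ℂ) →
      (braket (chainRun K W φ r) (onAB F 1 *ᵥ chainRun K W φ r)).re < t) :
    ∃ Z, StrictChain K F r Z ∧ (braket φ (onAB (Z 0) 1 *ᵥ φ)).re < t := by
  by_contra! hcon
  obtain ⟨W, hW, hle⟩ := exists_mem_unitaryGroup_le_chainRun hF r K φ hcon
  exact (h W hW).not_ge hle

end Chain

section EigenMajorant

theorem exists_majorant_of_compression {ι κ : Type*} [Fintype ι] [DecidableEq ι] [Fintype κ]
    {Z : Matrix ι ι ℂ} (hZ : Z.IsHermitian) {Y : Matrix κ κ ℂ} {R : Matrix κ ι ℂ}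
    (hR : IsIdempotentElem (Rᴴ * R)) (h : (Y - R * Z * Rᴴ).PosDef) :
    ∃ c : ℝ, (Rᴴ * Y * R + c • (1 - Rᴴ * R) - Z).PosSemidef := by
  let T : Matrix (κ ⊕ ι) ι ℂ := Matrix.fromRows R (1 - Rᴴ * R)
  have hTT : Tᴴ * T = 1 := conjTranspose_fromRows_mul_fromRows_one_sub hR
  have hTZT : Tᴴ * (T * Z * Tᴴ) * T = Z := by
    rw [Matrix.mul_assoc, Matrix.mul_assoc (T * Z), hTT, ← Matrix.mul_assoc, ← Matrix.mul_assoc,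
      hTT, Matrix.one_mul, Matrix.mul_one]
  obtain ⟨c, hc⟩ := exists_fromBlocks_sub_posSemidef hZ (1 - Rᴴ * R) h
  let D : Matrix (κ ⊕ ι) (κ ⊕ ι) ℂ := Matrix.fromBlocks Y 0 0 (c • 1)
  have hTDT : Tᴴ * D * T = Rᴴ * Y * R + c • (1 - Rᴴ * R) := by
    rw [Matrix.conjTranspose_fromRows_eq_fromCols_conjTranspose, Matrix.fromCols_mul_fromBlocks,
      Matrix.fromCols_mul_fromRows, Matrix.mul_zero, Matrix.mul_zero, add_zero, zero_add,
      Matrix.mul_smul, Matrix.mul_one, Matrix.smul_mul, Matrix.conjTranspose_sub,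
      Matrix.conjTranspose_one, (Matrix.isHermitian_conjTranspose_mul_self R).eq, hR.one_sub.eq]
  have hconj := hc.conjTranspose_mul_mul_same T
  rw [Matrix.mul_sub, Matrix.sub_mul, hTZT, hTDT] at hconj
  exact ⟨c, hconj⟩

theorem exists_eigen_majorant {ι : Type*} [Fintype ι] {Z : Matrix ι ι ℂ} (hZ : Z.IsHermitian)
    {ψ : ι → ℂ} (hψ : sqNorm ψ = 1) {β : ℝ} (hβ : (braket ψ (Z *ᵥ ψ)).re < β) :
    ∃ Y : Matrix ι ι ℂ, (Y - Z).PosSemidef ∧ Y *ᵥ ψ = (β : ℂ) • ψ := by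
  classical
  let R : Matrix Unit ι ℂ := Matrix.replicateRow Unit (star ψ)
  have hRψ : R *ᵥ ψ = 1 := by
    ext
    change braket ψ ψ = 1
    rw [braket_self, hψ, Complex.ofReal_one]
  have hR : Rᴴ = Matrix.replicateCol Unit ψ := by
    rw [Matrix.conjTranspose_replicateRow, star_star]
  have hR1 : Rᴴ *ᵥ 1 = ψ := by
    rw [hR]
    ext
    simp [Matrix.mulVec, dotProduct]
  have hRR : R * Rᴴ = 1 := by
    rw [hR]
    exact Matrix.ext fun _ _ => congrFun hRψ ()
  have hidem : IsIdempotentElem (Rᴴ * R) := by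
    rw [IsIdempotentElem, Matrix.mul_assoc, ← Matrix.mul_assoc R, hRR, Matrix.one_mul]
  have hRZR : R * Z * Rᴴ = (braket ψ (Z *ᵥ ψ)).re • 1 := by
    have hre : ((braket ψ (Z *ᵥ ψ)).re : ℂ) = braket ψ (Z *ᵥ ψ) :=
      Complex.ext rfl (hZ.im_star_dotProduct_mulVec_self ψ).symm
    rw [hR, ← Complex.coe_smul, hre, braket, Matrix.dotProduct_mulVec]
    refine Matrix.ext fun _ _ => ?_
    simp only [Matrix.smul_apply, Matrix.one_apply_eq, smul_eq_mul, mul_one]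
    rfl
  have hpos : (β • 1 - R * Z * Rᴴ).PosDef := by
    rw [hRZR, ← sub_smul]
    exact Matrix.PosDef.one.smul (sub_pos.2 hβ)
  obtain ⟨c, hc⟩ := exists_majorant_of_compression hZ hidem hpos
  refine ⟨_, hc, ?_⟩
  rw [Matrix.mul_smul, Matrix.mul_one, Matrix.smul_mul, Matrix.add_mulVec, Matrix.smul_mulVec,
    Matrix.smul_mulVec, Matrix.sub_mulVec, Matrix.one_mulVec, ← Matrix.mulVec_mulVec, hRψ, hR1,
    sub_self, smul_zero, add_zero, Complex.coe_smul]

variable {H M : Type*} [Fintype H] [Fintype M] [DecidableEq M]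

theorem StrictChain.exists_eigen [Nonempty M] {K : ℕ → Matrix (H × M) (H × M) ℂ} {F : Matrix H H ℂ}
    (hF : F.PosSemidef) {r : ℕ} {Z : ℕ → Matrix H H ℂ} (hZ : StrictChain K F (r + 1) Z)
    {ψ : H → ℂ} (hψ : sqNorm ψ = 1) {β : ℝ} (hβ : (braket ψ (Z 0 *ᵥ ψ)).re < β) :
    ∃ Z', StrictChain K F (r + 1) Z' ∧ Z' 0 *ᵥ ψ = (β : ℂ) • ψ := by
  obtain ⟨Y, hY, hYψ⟩ :=
    exists_eigen_majorant (hZ.posSemidef hF (Nat.zero_le _)).isHermitian hψ hβ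
  have htail : StrictChain (fun j => K (j + 1)) F r fun j => Z (j + 1) :=
    ⟨hZ.last, fun j hj => hZ.step (j + 1) (Nat.succ_lt_succ hj)⟩
  refine ⟨_, htail.cons (Z' := Y) ?_, hYψ⟩
  have h := (hZ.step 0 r.succ_pos).add_posSemidef (hY.kronecker (Matrix.PosSemidef.one (n := M)))
  rwa [sub_add_eq_add_sub, ← Matrix.add_kronecker, add_sub_cancel] at h

theorem exists_strictChain_eigen [DecidableEq H] {F : Matrix H H ℂ} (hF : F.PosSemidef) {ψ : H → ℂ}
    (hψ : sqNorm ψ = 1) {ω : M × Fin (Fintype.card (H × M)) → ℂ} (hω : sqNorm ω = 1) {β : ℝ}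
    (r : ℕ) (K : ℕ → Matrix (H × M) (H × M) ℂ)
    (h : ∀ W : ℕ → Matrix (M × Fin (Fintype.card (H × M))) (M × Fin (Fintype.card (H × M))) ℂ,
      (∀ j, W j ∈ Matrix.unitaryGroup (M × Fin (Fintype.card (H × M))) ℂ) →
      (braket (chainRun K W (tensorVec ψ ω) (r + 1))
        (onAB F 1 *ᵥ chainRun K W (tensorVec ψ ω) (r + 1))).re < β) :
    ∃ Z, StrictChain K F (r + 1) Z ∧ Z 0 *ᵥ ψ = (β : ℂ) • ψ := by
  have : Nonempty M := (nonempty_of_sqNorm_eq_one hω).map Prod.fst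
  obtain ⟨Z, hZ, hZβ⟩ := exists_strictChain_of_forall_chainRun_lt hF (r + 1) K (tensorVec ψ ω) h
  rw [onAB, Matrix.one_kronecker_one, kronecker_mulVec_tensorVec, Matrix.one_mulVec,
    braket_tensorVec, braket_self ω, hω, Complex.ofReal_one, mul_one] at hZβ
  exact hZ.exists_eigen hF hψ hZβ

end EigenMajorant

section Cheating

variable {A M B : Type*} [Fintype A] [DecidableEq A] [Fintype M] [DecidableEq M]
  [Fintype B] [DecidableEq B]

namespace Protocol

variable {P : Protocol A M B} (hP : P.IsWCF) {d : ℕ}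

include hP

theorem IsWCF.sqNorm_runB_le {ω : M × Fin d → ℂ} (hω : sqNorm ω = 1)
    {V : ℕ → Matrix (M × Fin d) (M × Fin d) ℂ} (hV : ∀ i, V i ∈ Matrix.unitaryGroup (M × Fin d) ℂ)
    {i : ℕ} (hi : i ≤ P.n) : sqNorm (P.runB ω V i) ≤ 1 := by
  induction i with
  | zero => rw [runB, sqNorm_tensorVec, hP.unit_ψA, hω, one_mul]
  | succ i ih =>
    refine le_trans ?_ (ih (Nat.le_of_succ_le hi))
    rw [runB]
    split_ifs with hodd
    · rw [onAM_mul]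
      exact sqNorm_mul_mulVec_le (isStarProjection_onAM (hP.proj_EA _ hodd hi))
        (onAM_mem_unitaryGroup (hP.unitary_UA _ hodd hi)) _
    · exact (sqNorm_mulVec_of_mem_unitaryGroup (onMB_mem_unitaryGroup (hV _)) _).le

theorem IsWCF.sqNorm_runA_le {ω : Fin d × M → ℂ} (hω : sqNorm ω = 1)
    {V : ℕ → Matrix (Fin d × M) (Fin d × M) ℂ} (hV : ∀ i, V i ∈ Matrix.unitaryGroup (Fin d × M) ℂ)
    {i : ℕ} (hi : i ≤ P.n) : sqNorm (P.runA ω V i) ≤ 1 := by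
  induction i with
  | zero =>
    have hassoc : P.runA ω V 0 = tensorVec ω P.ψB ∘ (Equiv.prodAssoc (Fin d) M B).symm := rfl
    rw [hassoc, sqNorm_comp_equiv, sqNorm_tensorVec, hω, hP.unit_ψB, one_mul]
  | succ i ih =>
    refine le_trans ?_ (ih (Nat.le_of_succ_le hi))
    rw [runA]
    split_ifs with hodd
    · exact (sqNorm_mulVec_of_mem_unitaryGroup (onAM_mem_unitaryGroup (hV _)) _).le
    · rw [Nat.not_odd_iff_even] at hodd
      rw [onMB_mul]
      exact sqNorm_mul_mulVec_le (isStarProjection_onMB (hP.proj_EB _ hodd i.succ_pos hi))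
        (onMB_mem_unitaryGroup (hP.unitary_UB _ hodd i.succ_pos hi)) _

theorem IsWCF.winB_nonneg (ω : M × Fin d → ℂ) (V : ℕ → Matrix (M × Fin d) (M × Fin d) ℂ) :
    0 ≤ P.winB ω V :=
  (onAB_posSemidef hP.posSemidef_FA1 Matrix.PosSemidef.one).re_dotProduct_nonneg _

theorem IsWCF.winA_nonneg (ω : Fin d × M → ℂ) (V : ℕ → Matrix (Fin d × M) (Fin d × M) ℂ) :
    0 ≤ P.winA ω V :=
  (onAB_posSemidef Matrix.PosSemidef.one hP.posSemidef_FB0).re_dotProduct_nonneg _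

theorem IsWCF.winB_le_one {ω : M × Fin d → ℂ} (hω : sqNorm ω = 1)
    {V : ℕ → Matrix (M × Fin d) (M × Fin d) ℂ}
    (hV : ∀ i, V i ∈ Matrix.unitaryGroup (M × Fin d) ℂ) : P.winB ω V ≤ 1 := by
  refine (re_braket_mulVec_le_sqNorm ?_ _).trans (hP.sqNorm_runB_le hω hV le_rfl)
  rw [← onAB_one_one, ← onAB_sub_left, ← hP.sum_FA, add_sub_cancel_right]
  exact onAB_posSemidef hP.posSemidef_FA0 Matrix.PosSemidef.one

theorem IsWCF.winA_le_one {ω : Fin d × M → ℂ} (hω : sqNorm ω = 1)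
    {V : ℕ → Matrix (Fin d × M) (Fin d × M) ℂ}
    (hV : ∀ i, V i ∈ Matrix.unitaryGroup (Fin d × M) ℂ) : P.winA ω V ≤ 1 := by
  refine (re_braket_mulVec_le_sqNorm ?_ _).trans (hP.sqNorm_runA_le hω hV le_rfl)
  rw [← onAB_one_one, ← onAB_sub_right, ← hP.sum_FB, add_sub_cancel_left]
  exact onAB_posSemidef Matrix.PosSemidef.one hP.posSemidef_FB1

theorem IsWCF.winB_le_optB {χ : Fin d → ℂ} (hχ : sqNorm χ = 1)
    {V : ℕ → Matrix (M × Fin d) (M × Fin d) ℂ}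
    (hV : ∀ i, V i ∈ Matrix.unitaryGroup (M × Fin d) ℂ) :
    P.winB (tensorVec P.ψM χ) V ≤ P.optB := by
  refine le_csSup ⟨1, ?_⟩ ⟨d, χ, V, hχ, hV, rfl⟩
  rintro _ ⟨d, χ, V, hχ, hV, rfl⟩
  exact hP.winB_le_one (by rw [sqNorm_tensorVec, hP.unit_ψM, hχ, one_mul]) hV

theorem IsWCF.winB_le_optBEarly {ω : M × Fin d → ℂ} (hω : sqNorm ω = 1)
    {V : ℕ → Matrix (M × Fin d) (M × Fin d) ℂ}
    (hV : ∀ i, V i ∈ Matrix.unitaryGroup (M × Fin d) ℂ) : P.winB ω V ≤ P.optBEarly := by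
  refine le_csSup ⟨1, ?_⟩ ⟨d, ω, V, hω, hV, rfl⟩
  rintro _ ⟨d, ω, V, hω, hV, rfl⟩
  exact hP.winB_le_one hω hV

theorem IsWCF.winA_le_optA {ω : Fin d × M → ℂ} (hω : sqNorm ω = 1)
    {V : ℕ → Matrix (Fin d × M) (Fin d × M) ℂ}
    (hV : ∀ i, V i ∈ Matrix.unitaryGroup (Fin d × M) ℂ) : P.winA ω V ≤ P.optA := by
  refine le_csSup ⟨1, ?_⟩ ⟨d, ω, V, hω, hV, rfl⟩
  rintro _ ⟨d, ω, V, hω, hV, rfl⟩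
  exact hP.winA_le_one hω hV

theorem IsWCF.optB_nonneg : 0 ≤ P.optB := by
  apply Real.sSup_nonneg
  rintro _ ⟨d, χ, V, -, -, rfl⟩
  exact hP.winB_nonneg _ _

theorem IsWCF.optBEarly_nonneg : 0 ≤ P.optBEarly := by
  apply Real.sSup_nonneg
  rintro _ ⟨d, ω, V, -, -, rfl⟩
  exact hP.winB_nonneg _ _

theorem IsWCF.optA_nonneg : 0 ≤ P.optA := by
  apply Real.sSup_nonneg
  rintro _ ⟨d, ω, V, -, -, rfl⟩
  exact hP.winA_nonneg _ _

end Protocol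

end Cheating

section Simulation

section Reverse

/-- The exchange of the two outer tensor factors, which turns a statement about Alice into one about
Bob. -/
def reverse (A M B : Type*) : B × M × A ≃ A × M × B where
  toFun x := (x.2.2, x.2.1, x.1)
  invFun x := (x.2.2, x.2.1, x.1)

variable {A M B : Type*} [Fintype A] [Fintype M] [Fintype B]

theorem mulVec_comp_equiv {ι κ : Type*} [Fintype ι] [Fintype κ] (X : Matrix ι ι ℂ) (v : ι → ℂ)
    (e : κ ≃ ι) : (X *ᵥ v) ∘ e = X.submatrix e e *ᵥ (v ∘ e) := by
  rw [Matrix.submatrix_mulVec_equiv, Function.comp_assoc, Equiv.self_comp_symm, Function.comp_id]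

theorem onMB_mulVec_comp_reverse [DecidableEq A] (X : Matrix (M × B) (M × B) ℂ)
    (v : A × M × B → ℂ) :
    (onMB X *ᵥ v) ∘ reverse A M B =
      onAM (X.submatrix Prod.swap Prod.swap) *ᵥ (v ∘ reverse A M B) := by
  rw [mulVec_comp_equiv]
  congr 1
  ext ⟨b, m, a⟩ ⟨b', m', a'⟩
  simp [onAM, onMB, reverse, mul_comm]

theorem onAM_mulVec_comp_reverse [DecidableEq B] (X : Matrix (A × M) (A × M) ℂ)
    (v : A × M × B → ℂ) :
    (onAM X *ᵥ v) ∘ reverse A M B =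
      onMB (X.submatrix Prod.swap Prod.swap) *ᵥ (v ∘ reverse A M B) := by
  rw [mulVec_comp_equiv]
  congr 1
  ext ⟨b, m, a⟩ ⟨b', m', a'⟩
  simp [onAM, onMB, reverse, mul_comm]

theorem onAB_mulVec_comp_reverse [DecidableEq M] (X : Matrix A A ℂ) (Y : Matrix B B ℂ)
    (v : A × M × B → ℂ) :
    (onAB X Y *ᵥ v) ∘ reverse A M B = onAB Y X *ᵥ (v ∘ reverse A M B) := by
  rw [mulVec_comp_equiv]
  congr 1
  ext ⟨b, m, a⟩ ⟨b', m', a'⟩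
  simp [onAB, reverse, mul_left_comm, mul_comm]

end Reverse

variable {A M B : Type*} [Fintype M]

namespace Protocol

/-- What honest Alice applies at her turn number `j = 0, 1, …`, which is round `2 * j + 1`. -/
def opA [Fintype A] (P : Protocol A M B) (j : ℕ) : Matrix (A × M) (A × M) ℂ :=
  P.EA (2 * j + 1) * P.UA (2 * j + 1)

/-- What honest Bob applies at his turn number `j = 0, 1, …`, which is round `2 * j + 2`, as an
operator on `ℬ ⊗ ℳ`. -/
def opB [Fintype B] (P : Protocol A M B) (j : ℕ) : Matrix (B × M) (B × M) ℂ :=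
  (P.EB (2 * j + 2) * P.UB (2 * j + 2)).submatrix Prod.swap Prod.swap

theorem runB_eq_onMB_chainRun [Fintype A] [DecidableEq A] (P : Protocol A M B) {d : ℕ}
    (ω : M × Fin d → ℂ) (W : ℕ → Matrix (M × Fin d) (M × Fin d) ℂ) (j : ℕ) :
    P.runB (W 0 *ᵥ ω) (fun i => W (i / 2)) (2 * j) =
      onMB (W j) *ᵥ chainRun P.opA W (tensorVec P.ψA ω) j := by
  induction j with
  | zero => rw [Nat.mul_zero, runB, chainRun, onMB_mulVec_tensorVec]
  | succ j ih =>
    have hodd : Odd (2 * j + 1) := odd_two_mul_add_one j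
    have heven : ¬ Odd (2 * j + 1 + 1) := by simp [parity_simps]
    have hhalf : (2 * j + 1 + 1) / 2 = j + 1 := by lia
    rw [Nat.mul_succ, runB, if_neg heven, runB, if_pos hodd, ih, chainRun, opA]
    simp only [hhalf]

theorem runA_comp_reverse [Fintype B] [DecidableEq B] (P : Protocol A M B) {d : ℕ}
    (ω : Fin d × M → ℂ) (W : ℕ → Matrix (M × Fin d) (M × Fin d) ℂ) (j : ℕ) :
    P.runA ω (fun i => (W (i / 2)).submatrix Prod.swap Prod.swap) (2 * j) ∘ reverse (Fin d) M B =
      chainRun P.opB W (tensorVec P.ψB (ω ∘ Prod.swap)) j := by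
  induction j with
  | zero =>
    ext x
    exact mul_comm _ _
  | succ j ih =>
    have hodd : Odd (2 * j + 1) := odd_two_mul_add_one j
    have heven : ¬ Odd (2 * j + 1 + 1) := by simp [parity_simps]
    have hhalf : (2 * j + 1) / 2 = j := by lia
    rw [Nat.mul_succ, runA, if_neg heven, runA, if_pos hodd, onMB_mulVec_comp_reverse,
      onAM_mulVec_comp_reverse, ih, chainRun, opB, Matrix.submatrix_submatrix, Prod.swap_swap_eq,
      Matrix.submatrix_id_id]
    simp only [hhalf]

/-- Bob's last operator acts after Alice's last round, hence does not influence her outcome. -/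
theorem winB_eq_chainRun [Fintype A] [DecidableEq A] [DecidableEq M] (P : Protocol A M B) {d : ℕ}
    (ω : M × Fin d → ℂ) {W : ℕ → Matrix (M × Fin d) (M × Fin d) ℂ} {r : ℕ} (hr : P.n = 2 * r)
    (hW : W r ∈ Matrix.unitaryGroup (M × Fin d) ℂ) :
    P.winB (W 0 *ᵥ ω) (fun i => W (i / 2)) =
      (braket (chainRun P.opA W (tensorVec P.ψA ω) r)
        (onAB P.FA1 1 *ᵥ chainRun P.opA W (tensorVec P.ψA ω) r)).re := by
  have hunitary := Matrix.mem_unitaryGroup_iff'.1 (onMB_mem_unitaryGroup (A := A) hW)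
  rw [Matrix.star_eq_conjTranspose] at hunitary
  rw [winB, hr, runB_eq_onMB_chainRun, braket_mulVec_mulVec, Matrix.mul_assoc,
    ← onMB_mul_onAB_one, ← Matrix.mul_assoc, hunitary, Matrix.one_mul]

theorem winA_eq_chainRun [DecidableEq M] [Fintype B] [DecidableEq B] (P : Protocol A M B) {d : ℕ}
    (ω : Fin d × M → ℂ) (W : ℕ → Matrix (M × Fin d) (M × Fin d) ℂ) {r : ℕ} (hr : P.n = 2 * r) :
    P.winA ω (fun i => (W (i / 2)).submatrix Prod.swap Prod.swap) =
      (braket (chainRun P.opB W (tensorVec P.ψB (ω ∘ Prod.swap)) r)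
        (onAB P.FB0 1 *ᵥ chainRun P.opB W (tensorVec P.ψB (ω ∘ Prod.swap)) r)).re := by
  rw [winA, hr, ← braket_comp_equiv (reverse _ M B), onAB_mulVec_comp_reverse, runA_comp_reverse]

variable [Fintype A] [DecidableEq A] [DecidableEq M] [Fintype B] [DecidableEq B]
  {P : Protocol A M B} (hP : P.IsWCF)

include hP

theorem IsWCF.honest_one (hn : 0 < P.n) :
    P.honest 1 = onAM (P.opA 0) *ᵥ tensorVec P.ψA (tensorVec P.ψM P.ψB) := by
  have hodd : Odd (0 + 1) := odd_one
  rw [← hP.E_honest 1 one_pos hn, honest, U, E, if_pos hodd, if_pos hodd, Matrix.mulVec_mulVec,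
    ← onAM_mul, honest, opA]

theorem IsWCF.exists_strictChain_of_optBEarly_lt {r : ℕ} (hr : P.n = 2 * (r + 1)) {β : ℝ}
    (hβ : P.optBEarly < β) :
    ∃ Z, StrictChain P.opA P.FA1 (r + 1) Z ∧ Z 0 *ᵥ P.ψA = (β : ℂ) • P.ψA := by
  have hA := nonempty_of_sqNorm_eq_one hP.unit_ψA
  have hM := nonempty_of_sqNorm_eq_one hP.unit_ψM
  have : NeZero (Fintype.card (A × M)) := ⟨Fintype.card_ne_zero⟩
  obtain ⟨ω, hω⟩ := exists_sqNorm_eq_one (M × Fin (Fintype.card (A × M)))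
  refine exists_strictChain_eigen hP.posSemidef_FA1 hP.unit_ψA hω r P.opA fun W hW => ?_
  rw [← P.winB_eq_chainRun ω hr (hW _)]
  refine (hP.winB_le_optBEarly ?_ fun i => hW _).trans_lt hβ
  rw [sqNorm_mulVec_of_mem_unitaryGroup (hW 0), hω]

theorem IsWCF.exists_strictChain_of_optB_lt {r : ℕ} (hr : P.n = 2 * (r + 1)) {β : ℝ}
    (hβ : P.optB < β) :
    ∃ Z, StrictChain (fun j => P.opA (j + 1)) P.FA1 r Z ∧
      (braket (P.honest 1) (onAB (Z 0) 1 *ᵥ P.honest 1)).re < β := by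
  have hA := nonempty_of_sqNorm_eq_one hP.unit_ψA
  have hM := nonempty_of_sqNorm_eq_one hP.unit_ψM
  have : NeZero (Fintype.card (A × M)) := ⟨Fintype.card_ne_zero⟩
  obtain ⟨χ, hχ⟩ := exists_sqNorm_eq_one (Fin (Fintype.card (A × M)))
  obtain ⟨Z, hZ, hZβ⟩ := exists_strictChain_of_forall_chainRun_lt hP.posSemidef_FA1 (t := β) r
    (fun j => P.opA (j + 1)) (onAM (P.opA 0) *ᵥ tensorVec P.ψA (tensorVec P.ψM χ)) fun W hW => by
      let W' : ℕ → Matrix (M × Fin (Fintype.card (A × M))) (M × Fin (Fintype.card (A × M))) ℂ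
        | 0 => 1
        | j + 1 => W j
      have hW' : ∀ j, W' j ∈ Matrix.unitaryGroup (M × Fin (Fintype.card (A × M))) ℂ
        | 0 => one_mem _
        | j + 1 => hW j
      have hle := hP.winB_le_optB hχ fun i => hW' (i / 2)
      have hwin := P.winB_eq_chainRun (tensorVec P.ψM χ) hr (hW' _)
      rw [chainRun_succ_eq_chainRun] at hwin
      simp only [W', Matrix.one_mulVec, onMB_one] at hwin hle
      exact (hwin ▸ hle).trans_lt hβ
  refine ⟨Z, hZ, ?_⟩
  rw [← onAM_kronecker_one, braket_onAM_mulVec_tensorVec, hχ] at hZβ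
  rwa [hP.honest_one (by lia), ← onAM_kronecker_one, braket_onAM_mulVec_tensorVec, hP.unit_ψB]

theorem IsWCF.exists_strictChain_of_optA_lt {r : ℕ} (hr : P.n = 2 * (r + 1)) {α : ℝ}
    (hα : P.optA < α) :
    ∃ Z, StrictChain P.opB P.FB0 (r + 1) Z ∧ Z 0 *ᵥ P.ψB = (α : ℂ) • P.ψB := by
  have hB := nonempty_of_sqNorm_eq_one hP.unit_ψB
  have hM := nonempty_of_sqNorm_eq_one hP.unit_ψM
  have : NeZero (Fintype.card (B × M)) := ⟨Fintype.card_ne_zero⟩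
  obtain ⟨ω, hω⟩ := exists_sqNorm_eq_one (Fin (Fintype.card (B × M)) × M)
  have hω' : sqNorm (ω ∘ Prod.swap) = 1 := by
    rw [← hω]
    exact sqNorm_comp_equiv (Equiv.prodComm _ _) ω
  refine exists_strictChain_eigen hP.posSemidef_FB0 hP.unit_ψB hω' r P.opB fun W hW => ?_
  rw [← P.winA_eq_chainRun ω W hr]
  refine (hP.winA_le_optA hω fun i => ?_).trans_lt hα
  exact submatrix_equiv_mem_unitaryGroup (Equiv.prodComm _ _) (hW _)

end Protocol

end Simulation

section PointGame

section EigenProjection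

variable {ι κ : Type*} [Fintype ι] [DecidableEq ι]

theorem eigProj_eq {Z P : Matrix ι ι ℂ} {z : ℝ} (hP : P.IsHermitian) (hZP : Z * P = (z : ℂ) • P)
    (h : ∀ w, Z *ᵥ w = (z : ℂ) • w → P *ᵥ w = w) : eigProj Z z = P := by
  have heigen (v : ι → ℂ) : Z *ᵥ (P *ᵥ v) = (z : ℂ) • (P *ᵥ v) := by
    rw [Matrix.mulVec_mulVec, hZP, Matrix.smul_mulVec]
  refine Matrix.ext_iff_mulVec.2 fun v => eigProj_mulVec_eq (heigen v) fun w hw => ?_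
  rw [← h w hw, star_mulVec_dotProduct, hP.eq, Matrix.mulVec_sub, h _ (heigen v), sub_self,
    dotProduct_zero]

theorem eigProj_mul_of_eigen [Finite κ] {Z : Matrix ι ι ℂ} {z : ℝ} {Φ : Matrix ι κ ℂ}
    (h : Z * Φ = (z : ℂ) • Φ) : eigProj Z z * Φ = Φ := by
  have := Fintype.ofFinite κ
  refine Matrix.ext_iff_mulVec.2 fun v => ?_
  rw [← Matrix.mulVec_mulVec]
  exact eigProj_mulVec_of_eigen (by rw [Matrix.mulVec_mulVec, h, Matrix.smul_mulVec])

variable [Fintype κ] [DecidableEq κ]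

theorem eigProj_kronecker_one (Z : Matrix ι ι ℂ) (z : ℝ) :
    eigProj (Z ⊗ₖ (1 : Matrix κ κ ℂ)) z = eigProj Z z ⊗ₖ (1 : Matrix κ κ ℂ) := by
  refine eigProj_eq ?_ ?_ fun w hw => ?_
  · rw [Matrix.IsHermitian, Matrix.conjTranspose_kronecker, (eigProj_isHermitian Z z).eq,
      Matrix.conjTranspose_one]
  · rw [← Matrix.mul_kronecker_mul, mul_eigProj, Matrix.one_mul, Matrix.smul_kronecker]
  · let Φ : Matrix ι κ ℂ := Matrix.of fun i k => w (i, k)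
    have hΦ : Z * Φ = (z : ℂ) • Φ :=
      Matrix.transpose_injective (Matrix.vec_inj.1
        ((kronecker_one_mulVec_vec_transpose Z Φ).symm.trans hw))
    exact (kronecker_one_mulVec_vec_transpose _ Φ).trans (by rw [eigProj_mul_of_eigen hΦ]; rfl)

theorem eigProj_one_kronecker (Z : Matrix ι ι ℂ) (z : ℝ) :
    eigProj ((1 : Matrix κ κ ℂ) ⊗ₖ Z) z = (1 : Matrix κ κ ℂ) ⊗ₖ eigProj Z z := by
  have hslice (X : Matrix ι ι ℂ) (Φ : Matrix ι κ ℂ) :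
      ((1 : Matrix κ κ ℂ) ⊗ₖ X) *ᵥ Φ.vec = (X * Φ).vec := by
    rw [Matrix.kronecker_mulVec_vec, Matrix.transpose_one, Matrix.mul_one]
  refine eigProj_eq ?_ ?_ fun w hw => ?_
  · rw [Matrix.IsHermitian, Matrix.conjTranspose_kronecker, (eigProj_isHermitian Z z).eq,
      Matrix.conjTranspose_one]
  · rw [← Matrix.mul_kronecker_mul, mul_eigProj, Matrix.one_mul, Matrix.kronecker_smul]
  · let Φ : Matrix ι κ ℂ := Matrix.of fun i k => w (k, i)
    have hΦ : Z * Φ = (z : ℂ) • Φ := Matrix.vec_inj.1 ((hslice Z Φ).symm.trans hw)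
    exact (hslice _ Φ).trans (by rw [eigProj_mul_of_eigen hΦ]; rfl)

theorem prob_of_eigen {Z : Matrix ι ι ℂ} (hZ : Z.IsHermitian) {z : ℝ≥0} {v : ι → ℂ}
    (hv : Z *ᵥ v = ((z : ℝ) : ℂ) • v) (x : ℝ≥0) : prob Z v x = if x = z then sqNorm v else 0 := by
  split_ifs with h
  · rw [h, prob, eigProj_mulVec_of_eigen hv, sqNorm_eq_re_braket]
  · rw [prob, eigProj_mulVec_of_ne hZ (fun h' => h (NNReal.coe_injective h')) hv, braket,
      dotProduct_zero, Complex.zero_re]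

theorem prob_eigProj_mulVec_of_eigen {X Y : Matrix ι ι ℂ} (hX : X.IsHermitian)
    (hY : Y.IsHermitian) {ψ : ι → ℂ} (hψ : sqNorm ψ = 1) {β α : ℝ≥0}
    (hβ : X *ᵥ ψ = ((β : ℝ) : ℂ) • ψ) (hα : Y *ᵥ ψ = ((α : ℝ) : ℂ) • ψ) (x y : ℝ≥0) :
    prob X (eigProj Y y *ᵥ ψ) x = point β α (x, y) := by
  by_cases hy : y = α
  · simp [hy, eigProj_mulVec_of_eigen hα, prob_of_eigen hX hβ, hψ, point]
  · rw [eigProj_mulVec_of_ne hY (fun h => hy (NNReal.coe_injective h)) hα]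
    simp [prob, braket, point, hy]

end EigenProjection

variable {A M B : Type*} [DecidableEq M]

theorem onAB_conjTranspose (X : Matrix A A ℂ) (Y : Matrix B B ℂ) :
    (onAB X Y : Matrix (A × M × B) (A × M × B) ℂ)ᴴ = onAB Xᴴ Yᴴ := by
  rw [onAB, onAB, Matrix.conjTranspose_kronecker, Matrix.conjTranspose_kronecker,
    Matrix.conjTranspose_one]

variable [Fintype A] [DecidableEq A] [Fintype M] [Fintype B] [DecidableEq B]

theorem eigProj_onAB_one_right (Z : Matrix A A ℂ) (z : ℝ) :
    eigProj (onAB Z 1 : Matrix (A × M × B) (A × M × B) ℂ) z = onAB (eigProj Z z) 1 := by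
  rw [onAB, onAB, Matrix.one_kronecker_one, eigProj_kronecker_one]

theorem eigProj_onAB_one_left (Z : Matrix B B ℂ) (z : ℝ) :
    eigProj (onAB 1 Z : Matrix (A × M × B) (A × M × B) ℂ) z = onAB 1 (eigProj Z z) := by
  rw [onAB, onAB, eigProj_one_kronecker, eigProj_one_kronecker]

theorem prob₂_eq_prob_left (ZA : Matrix A A ℂ) (ZB : Matrix B B ℂ) (ψ : A × M × B → ℂ)
    (x y : ℝ≥0) :
    prob₂ ZA ZB ψ (x, y) = prob (onAB ZA 1) (onAB 1 (eigProj ZB y) *ᵥ ψ) x := by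
  rw [prob, braket_mulVec_mulVec, eigProj_onAB_one_right, onAB_conjTranspose, ← onAB_mul,
    ← onAB_mul, (eigProj_isHermitian ZB y).eq, Matrix.conjTranspose_one, Matrix.mul_one,
    Matrix.mul_one, Matrix.one_mul, eigProj_mul_self, prob₂]

theorem prob₂_eq_prob_right (ZA : Matrix A A ℂ) (ZB : Matrix B B ℂ) (ψ : A × M × B → ℂ)
    (x y : ℝ≥0) :
    prob₂ ZA ZB ψ (x, y) = prob (onAB 1 ZB) (onAB (eigProj ZA x) 1 *ᵥ ψ) y := by
  rw [prob, braket_mulVec_mulVec, eigProj_onAB_one_left, onAB_conjTranspose, ← onAB_mul,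
    ← onAB_mul, (eigProj_isHermitian ZA x).eq, Matrix.conjTranspose_one, Matrix.mul_one,
    Matrix.mul_one, Matrix.one_mul, eigProj_mul_self, prob₂]

theorem prob₂_eq_sqNorm (ZA : Matrix A A ℂ) (ZB : Matrix B B ℂ) (ψ : A × M × B → ℂ)
    (z : ℝ≥0 × ℝ≥0) :
    prob₂ ZA ZB ψ z = sqNorm (onAB (eigProj ZA z.1) (eigProj ZB z.2) *ᵥ ψ) := by
  rw [sqNorm_mulVec, onAB_conjTranspose, ← onAB_mul, (eigProj_isHermitian _ _).eq,
    (eigProj_isHermitian _ _).eq, eigProj_mul_self, eigProj_mul_self, prob₂]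

theorem prob₂_nonneg (ZA : Matrix A A ℂ) (ZB : Matrix B B ℂ) (ψ : A × M × B → ℂ)
    (z : ℝ≥0 × ℝ≥0) : 0 ≤ prob₂ ZA ZB ψ z := by
  rw [prob₂_eq_sqNorm, sqNorm]
  positivity

theorem finite_support_prob₂ (ZA : Matrix A A ℂ) (ZB : Matrix B B ℂ) (ψ : A × M × B → ℂ) :
    (Function.support (prob₂ ZA ZB ψ)).Finite := by
  refine ((finite_setOf_eigProj_ne_zero ZA).prod (finite_setOf_eigProj_ne_zero ZB)).subset ?_
  intro z hz
  refine ⟨fun h => hz ?_, fun h => hz ?_⟩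
  · simp [prob₂, onAB, h, braket]
  · simp [prob₂, onAB, h, braket]

theorem prob₂_of_eigen {ZA : Matrix A A ℂ} {ZB : Matrix B B ℂ} (hZA : ZA.IsHermitian)
    (hZB : ZB.IsHermitian) {ψ : A × M × B → ℂ} (hψ : sqNorm ψ = 1) {β α : ℝ≥0}
    (hβ : onAB ZA 1 *ᵥ ψ = ((β : ℝ) : ℂ) • ψ) (hα : onAB 1 ZB *ᵥ ψ = ((α : ℝ) : ℂ) • ψ) :
    prob₂ ZA ZB ψ = point β α := by
  funext ⟨x, y⟩
  rw [prob₂_eq_prob_left, ← eigProj_onAB_one_left]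
  refine prob_eigProj_mulVec_of_eigen ?_ ?_ hψ hβ hα x y
  · rw [Matrix.IsHermitian, onAB_conjTranspose, hZA.eq, Matrix.conjTranspose_one]
  · rw [Matrix.IsHermitian, onAB_conjTranspose, hZB.eq, Matrix.conjTranspose_one]

theorem ebmHorizontal_prob₂_point {ZA : Matrix A A ℂ} {ZB : Matrix B B ℂ} (hZA : ZA.PosSemidef)
    (hZB : ZB.IsHermitian) {ψ : A × M × B → ℂ} (hψ : sqNorm ψ = 1) {β α : ℝ≥0}
    (hβ : (braket ψ (onAB ZA 1 *ᵥ ψ)).re < β) (hα : onAB 1 ZB *ᵥ ψ = ((α : ℝ) : ℂ) • ψ) :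
    EBMHorizontal (prob₂ ZA ZB ψ) (point β α) := by
  intro y
  have hZA₁ : (onAB ZA 1 : Matrix (A × M × B) (A × M × B) ℂ).PosSemidef :=
    onAB_posSemidef hZA Matrix.PosSemidef.one
  obtain ⟨Y, hY, hYψ⟩ := exists_eigen_majorant hZA₁.isHermitian hψ hβ
  have hYherm : Y.IsHermitian := by
    rw [← sub_add_cancel Y (onAB ZA 1)]
    exact hY.isHermitian.add hZA₁.isHermitian
  have hZB₁ : (onAB 1 ZB : Matrix (A × M × B) (A × M × B) ℂ).IsHermitian := by
    rw [Matrix.IsHermitian, onAB_conjTranspose, hZB.eq, Matrix.conjTranspose_one]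
  simp only [prob₂_eq_prob_left, ← eigProj_onAB_one_left]
  simp only [← prob_eigProj_mulVec_of_eigen hYherm hZB₁ hψ hYψ hα]
  exact EBMLine.of_posSemidef hZA₁ hY _

end PointGame

section FinalMeasurement

variable {A M B : Type*} [Fintype A] [DecidableEq A] [Fintype M] [DecidableEq M]
  [Fintype B] [DecidableEq B]

theorem onAB_eigProj_mulVec_of_eigen {ZA : Matrix A A ℂ} {ZB : Matrix B B ℂ} {a b : ℝ}
    {u : A × M × B → ℂ} (ha : onAB ZA 1 *ᵥ u = (a : ℂ) • u) (hb : onAB 1 ZB *ᵥ u = (b : ℂ) • u) :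
    onAB (eigProj ZA a) (eigProj ZB b) *ᵥ u = u := by
  have hsplit : (onAB (eigProj ZA a) (eigProj ZB b) : Matrix (A × M × B) (A × M × B) ℂ) =
      onAB (eigProj ZA a) 1 * onAB 1 (eigProj ZB b) := by
    rw [← onAB_mul, Matrix.mul_one, Matrix.one_mul]
  rw [hsplit, ← Matrix.mulVec_mulVec, ← eigProj_onAB_one_left, eigProj_mulVec_of_eigen hb,
    ← eigProj_onAB_one_right, eigProj_mulVec_of_eigen ha]

theorem onAB_eigProj_mulVec_onAB_mulVec {F : Matrix A A ℂ} {G : Matrix B B ℂ}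
    (hF : F.IsHermitian) (hG : G.IsHermitian) (x y : ℝ) (ψ : A × M × B → ℂ) :
    onAB (eigProj F x) (eigProj G y) *ᵥ (onAB F G *ᵥ ψ) =
      ((x * y : ℝ) : ℂ) • (onAB (eigProj F x) (eigProj G y) *ᵥ ψ) := by
  rw [Matrix.mulVec_mulVec, ← onAB_mul, eigProj_mul hF, eigProj_mul hG, onAB, onAB,
    Matrix.smul_kronecker, Matrix.kronecker_smul, Matrix.kronecker_smul, smul_smul,
    Matrix.smul_mulVec, Complex.ofReal_mul]

variable {F : Matrix A A ℂ} {G : Matrix B B ℂ} (hF : F.IsHermitian) (hG : G.IsHermitian)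
  {ψ : A × M × B → ℂ} (h₁ : onAB F G *ᵥ ψ = 0) (h₀ : onAB (1 - F) (1 - G) *ᵥ ψ = 0)

include hF hG h₁ h₀

theorem onAB_eigProj_zero_one_mulVec :
    onAB (eigProj F 0) (eigProj G 1) *ᵥ ψ = onAB (1 - F) G *ᵥ ψ := by
  have hF0 : onAB F 1 *ᵥ (onAB (1 - F) G *ᵥ ψ) = ((0 : ℝ) : ℂ) • (onAB (1 - F) G *ᵥ ψ) := by
    have h : onAB (1 - F) 1 *ᵥ (onAB F G *ᵥ ψ) = 0 := by rw [h₁, Matrix.mulVec_zero]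
    rw [Complex.ofReal_zero, zero_smul, ← h, Matrix.mulVec_mulVec, Matrix.mulVec_mulVec,
      ← onAB_mul, ← onAB_mul]
    simp only [Matrix.mul_sub, Matrix.sub_mul, Matrix.mul_one, Matrix.one_mul]
  have hG1 : onAB 1 G *ᵥ (onAB (1 - F) G *ᵥ ψ) = ((1 : ℝ) : ℂ) • (onAB (1 - F) G *ᵥ ψ) := by
    have h : onAB 1 G *ᵥ (onAB (1 - F) (1 - G) *ᵥ ψ) = 0 := by rw [h₀, Matrix.mulVec_zero]
    rw [onAB_sub_right, Matrix.sub_mulVec, Matrix.mulVec_sub, sub_eq_zero] at h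
    rw [Complex.ofReal_one, one_smul, ← h, Matrix.mulVec_mulVec, ← onAB_mul, Matrix.one_mul,
      Matrix.mul_one]
  have hP : eigProj F 0 * (1 - F) = eigProj F 0 := by
    rw [Matrix.mul_sub, eigProj_mul hF, Complex.ofReal_zero, zero_smul, sub_zero, Matrix.mul_one]
  have hQ : eigProj G 1 * G = eigProj G 1 := by
    rw [eigProj_mul hG, Complex.ofReal_one, one_smul]
  rw [← onAB_eigProj_mulVec_of_eigen hF0 hG1, Matrix.mulVec_mulVec, ← onAB_mul, hP, hQ]

theorem onAB_eigProj_one_zero_mulVec :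
    onAB (eigProj F 1) (eigProj G 0) *ᵥ ψ = onAB F (1 - G) *ᵥ ψ := by
  have h := onAB_eigProj_zero_one_mulVec (Matrix.isHermitian_one.sub hF)
    (Matrix.isHermitian_one.sub hG) h₀ (by rwa [sub_sub_cancel, sub_sub_cancel])
  have hF1 := eigProj_one_sub F 1
  have hG0 := eigProj_one_sub G 0
  rw [sub_self] at hF1
  rw [sub_zero] at hG0
  rwa [hF1, hG0, sub_sub_cancel] at h

theorem eq_zero_one_or_eq_one_zero_of_onAB_eigProj_mulVec_ne_zero {x y : ℝ}
    (h : onAB (eigProj F x) (eigProj G y) *ᵥ ψ ≠ 0) : x = 0 ∧ y = 1 ∨ x = 1 ∧ y = 0 := by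
  have hxy := onAB_eigProj_mulVec_onAB_mulVec hF hG x y ψ
  rw [h₁, Matrix.mulVec_zero, eq_comm, smul_eq_zero_iff_left h, Complex.ofReal_eq_zero,
    mul_eq_zero] at hxy
  have hxy' := onAB_eigProj_mulVec_onAB_mulVec (Matrix.isHermitian_one.sub hF)
    (Matrix.isHermitian_one.sub hG) (1 - x) (1 - y) ψ
  rw [eigProj_one_sub, eigProj_one_sub, h₀, Matrix.mulVec_zero, eq_comm, smul_eq_zero_iff_left h,
    Complex.ofReal_eq_zero, mul_eq_zero] at hxy'
  grind

end FinalMeasurement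

section Honest

variable {A M B : Type*} [Fintype A] [DecidableEq A] [Fintype M] [DecidableEq M]
  [Fintype B] [DecidableEq B] {P : Protocol A M B}

namespace Protocol

theorem onAB_one_mulVec_honest_zero {Z : Matrix A A ℂ} {β : ℂ} (h : Z *ᵥ P.ψA = β • P.ψA) :
    onAB Z 1 *ᵥ P.honest 0 = β • P.honest 0 := by
  rw [honest, onAB_mulVec_tensorVec, h, Matrix.one_mulVec]
  ext x
  exact mul_assoc _ _ _

theorem onAB_one_left_mulVec_honest_zero {Z : Matrix B B ℂ} {α : ℂ} (h : Z *ᵥ P.ψB = α • P.ψB) :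
    onAB 1 Z *ᵥ P.honest 0 = α • P.honest 0 := by
  rw [honest, onAB_mulVec_tensorVec, h, Matrix.one_mulVec]
  ext x
  simp only [tensorVec, Pi.smul_apply, smul_eq_mul, mul_left_comm]

variable (hP : P.IsWCF)

include hP

theorem IsWCF.sqNorm_honest_zero : sqNorm (P.honest 0) = 1 := by
  rw [honest, sqNorm_tensorVec, sqNorm_tensorVec, hP.unit_ψA, hP.unit_ψM, hP.unit_ψB, one_mul,
    one_mul]

theorem IsWCF.n_ne_zero : P.n ≠ 0 := by
  intro h
  have h01 := congrArg sqNorm hP.correct_01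
  have hA := hP.balanced_A
  have hB := hP.balanced_B
  rw [h, honest, onAB_mulVec_tensorVec, sqNorm_tensorVec, sqNorm_tensorVec, hP.unit_ψM, one_mul]
    at h01 hA hB
  rw [show sqNorm (0 : A × M × B → ℂ) = 0 by simp [sqNorm], mul_eq_zero] at h01
  rcases h01 with h01 | h01 <;> simp [h01] at hA hB

theorem IsWCF.prob₂_init :
    prob₂ P.FA1 P.FB0 (P.honest P.n) = (1 / 2 : ℝ) • point 0 1 + (1 / 2 : ℝ) • point 1 0 := by
  have hFA0 : P.FA0 = 1 - P.FA1 := eq_sub_of_add_eq hP.sum_FA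
  have hFB1 : P.FB1 = 1 - P.FB0 := eq_sub_of_add_eq' hP.sum_FB
  have hF := hP.posSemidef_FA1.isHermitian
  have hG := hP.posSemidef_FB0.isHermitian
  have h₁ := hP.correct_10
  have h₀ := hP.correct_01
  rw [hFA0, hFB1] at h₀
  have h01 := onAB_eigProj_zero_one_mulVec hF hG h₁ h₀
  have h10 := onAB_eigProj_one_zero_mulVec hF hG h₁ h₀
  rw [← hFA0] at h01
  rw [← hFB1] at h10
  funext ⟨x, y⟩
  rw [prob₂_eq_sqNorm]
  by_cases h : onAB (eigProj P.FA1 x) (eigProj P.FB0 y) *ᵥ P.honest P.n = 0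
  · have hx01 : (x, y) ≠ (0, 1) := by
      rintro ⟨⟩
      have := hP.balanced_A
      rw [← h01, ← NNReal.coe_zero, ← NNReal.coe_one, h] at this
      simp [sqNorm] at this
    have hx10 : (x, y) ≠ (1, 0) := by
      rintro ⟨⟩
      have := hP.balanced_B
      rw [← h10, ← NNReal.coe_zero, ← NNReal.coe_one, h] at this
      simp [sqNorm] at this
    simp [h, point, hx01, hx10, sqNorm]
  · have hxy := eq_zero_one_or_eq_one_zero_of_onAB_eigProj_mulVec_ne_zero hF hG h₁ h₀ h
    norm_cast at hxy
    obtain ⟨rfl, rfl⟩ | ⟨rfl, rfl⟩ := hxy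
    · simp [h01, hP.balanced_A, point]
    · simp [h10, hP.balanced_B, point]

theorem IsWCF.prob₂_final {ZA : Matrix A A ℂ} {ZB : Matrix B B ℂ} (hZA : ZA.IsHermitian)
    (hZB : ZB.IsHermitian) {β α : ℝ≥0} (hβ : ZA *ᵥ P.ψA = ((β : ℝ) : ℂ) • P.ψA)
    (hα : ZB *ᵥ P.ψB = ((α : ℝ) : ℂ) • P.ψB) : prob₂ ZA ZB (P.honest 0) = point β α :=
  prob₂_of_eigen hZA hZB hP.sqNorm_honest_zero (onAB_one_mulVec_honest_zero hβ)
    (onAB_one_left_mulVec_honest_zero hα)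

end Protocol

end Honest

section HonestRounds

namespace Protocol

variable {A M B : Type*} [Fintype A] [DecidableEq A] [Fintype M] [Fintype B] [DecidableEq B]
  {P : Protocol A M B}

theorem honest_succ_of_odd {i : ℕ} (hi : Odd (i + 1)) :
    P.honest (i + 1) = onAM (P.UA (i + 1)) *ᵥ P.honest i := by
  rw [honest, U, if_pos hi]

theorem honest_succ_of_even {i : ℕ} (hi : Even (i + 1)) :
    P.honest (i + 1) = onMB (P.UB (i + 1)) *ᵥ P.honest i := by
  rw [honest, U, if_neg (Nat.not_odd_iff_even.2 hi)]

variable [DecidableEq M] (hP : P.IsWCF)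

include hP

theorem IsWCF.ebmHorizontal {i : ℕ} (hi : Odd (i + 1)) (hin : i < P.n) {Z Z' : Matrix A A ℂ}
    (ZB : Matrix B B ℂ) (hZ : Z.PosSemidef)
    (h : (Z' ⊗ₖ (1 : Matrix M M ℂ) - (P.EA (i + 1) * P.UA (i + 1))ᴴ *
      (Z ⊗ₖ (1 : Matrix M M ℂ)) * (P.EA (i + 1) * P.UA (i + 1))).PosDef) :
    EBMHorizontal (prob₂ Z ZB (P.honest (i + 1))) (prob₂ Z' ZB (P.honest i)) := by
  intro y
  simp only [prob₂_eq_prob_left]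
  have hE := hP.E_honest (i + 1) i.succ_pos hin
  rw [E, if_pos hi] at hE
  have hproj := hP.proj_EA _ hi hin
  have hU : onAM (P.UA (i + 1)) *ᵥ (onAB 1 (eigProj ZB y) *ᵥ P.honest i) =
      onAB 1 (eigProj ZB y) *ᵥ P.honest (i + 1) := by
    rw [honest_succ_of_odd hi, Matrix.mulVec_mulVec, Matrix.mulVec_mulVec, onAM_mul_onAB_one]
  rw [← hU]
  refine EBMLine.of_compression (E := onAM (P.EA (i + 1))) (onAB_posSemidef hZ .one)
    (onAM_mem_unitaryGroup (hP.unitary_UA _ hi hin)) (isStarProjection_onAM hproj) ?_ ?_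
  · rw [hU, Matrix.mulVec_mulVec, onAM_mul_onAB_one, ← Matrix.mulVec_mulVec, hE]
  · convert onAM_posDef (B := B) h using 1
    have hEh : (P.EA (i + 1))ᴴ = P.EA (i + 1) := hproj.isSelfAdjoint
    rw [onAM_sub, onAM_kronecker_one, Matrix.conjTranspose_mul, hEh]
    simp only [onAM_mul, onAM_kronecker_one, onAM_conjTranspose, Matrix.mul_assoc]

theorem IsWCF.ebmVertical {i : ℕ} (hi : Even (i + 1)) (hin : i < P.n) {Z Z' : Matrix B B ℂ}
    (ZA : Matrix A A ℂ) (hZ : Z.PosSemidef)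
    (h : ((1 : Matrix M M ℂ) ⊗ₖ Z' - (P.EB (i + 1) * P.UB (i + 1))ᴴ *
      ((1 : Matrix M M ℂ) ⊗ₖ Z) * (P.EB (i + 1) * P.UB (i + 1))).PosDef) :
    EBMVertical (prob₂ ZA Z (P.honest (i + 1))) (prob₂ ZA Z' (P.honest i)) := by
  intro x
  simp only [prob₂_eq_prob_right]
  have hE := hP.E_honest (i + 1) i.succ_pos hin
  rw [E, if_neg (Nat.not_odd_iff_even.2 hi)] at hE
  have hproj := hP.proj_EB _ hi i.succ_pos hin
  have hU : onMB (P.UB (i + 1)) *ᵥ (onAB (eigProj ZA x) 1 *ᵥ P.honest i) =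
      onAB (eigProj ZA x) 1 *ᵥ P.honest (i + 1) := by
    rw [honest_succ_of_even hi, Matrix.mulVec_mulVec, Matrix.mulVec_mulVec, onMB_mul_onAB_one]
  rw [← hU]
  refine EBMLine.of_compression (E := onMB (P.EB (i + 1))) (onAB_posSemidef .one hZ)
    (onMB_mem_unitaryGroup (hP.unitary_UB _ hi i.succ_pos hin)) (isStarProjection_onMB hproj) ?_ ?_
  · rw [hU, Matrix.mulVec_mulVec, onMB_mul_onAB_one, ← Matrix.mulVec_mulVec, hE]
  · convert onMB_posDef (A := A) h using 1
    have hEh : (P.EB (i + 1))ᴴ = P.EB (i + 1) := hproj.isSelfAdjoint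
    rw [onMB_sub, onMB_one_kronecker, Matrix.conjTranspose_mul, hEh]
    simp only [onMB_mul, onMB_one_kronecker, onMB_conjTranspose, Matrix.mul_assoc]

theorem IsWCF.ebmHorizontal_honest_one_point {ZA : Matrix A A ℂ} (hZA : ZA.PosSemidef)
    {ZB : Matrix B B ℂ} (hZB : ZB.IsHermitian) {β α : ℝ≥0}
    (hβ : (braket (P.honest 1) (onAB ZA 1 *ᵥ P.honest 1)).re < β)
    (hα : ZB *ᵥ P.ψB = ((α : ℝ) : ℂ) • P.ψB) :
    EBMHorizontal (prob₂ ZA ZB (P.honest 1)) (point β α) := by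
  have hone : P.honest 1 = onAM (P.UA 1) *ᵥ P.honest 0 := honest_succ_of_odd odd_one
  refine ebmHorizontal_prob₂_point hZA hZB ?_ hβ ?_
  · have hU := hP.unitary_UA 1 odd_one (Nat.one_le_iff_ne_zero.2 hP.n_ne_zero)
    rw [hone, sqNorm_mulVec_of_mem_unitaryGroup (onAM_mem_unitaryGroup hU), hP.sqNorm_honest_zero]
  · rw [hone, Matrix.mulVec_mulVec, ← onAM_mul_onAB_one, ← Matrix.mulVec_mulVec,
      onAB_one_left_mulVec_honest_zero hα, Matrix.mulVec_smul]

end Protocol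

end HonestRounds

section StrictDual

variable {A M B : Type*} [Fintype M] [DecidableEq M]

theorem posDef_one_kronecker_sub_of_swap [Fintype B] {Z Z' : Matrix B B ℂ}
    {K : Matrix (M × B) (M × B) ℂ}
    (h : (Z' ⊗ₖ (1 : Matrix M M ℂ) - (K.submatrix Prod.swap Prod.swap)ᴴ *
      (Z ⊗ₖ (1 : Matrix M M ℂ)) * K.submatrix Prod.swap Prod.swap).PosDef) :
    ((1 : Matrix M M ℂ) ⊗ₖ Z' - Kᴴ * ((1 : Matrix M M ℂ) ⊗ₖ Z) * K).PosDef := by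
  let e : B × M ≃ M × B := Equiv.prodComm B M
  have hswap (X : Matrix B B ℂ) :
      (X ⊗ₖ (1 : Matrix M M ℂ)) = ((1 : Matrix M M ℂ) ⊗ₖ X).submatrix e e := by
    ext ⟨b, m⟩ ⟨b', m'⟩
    exact mul_comm _ _
  change (_ - (K.submatrix e e)ᴴ * _ * K.submatrix e e).PosDef at h
  rw [hswap, hswap, Matrix.conjTranspose_submatrix, Matrix.submatrix_mul_equiv,
    Matrix.submatrix_mul_equiv] at h
  convert h.submatrix e.symm.injective using 1
  ext ⟨m, b⟩ ⟨m', b'⟩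
  rfl

namespace Protocol

section Alice

variable [Fintype A]

/-- A dual feasible point `Z_k, …, Z_n` bounding Bob's cheating, without its eigenvalue condition,
whose inequalities are strict. With `k = 1` it leaves out Alice's first round, before which a
cheating Bob has no access to the message space. -/
structure IsStrictDualA (P : Protocol A M B) (k : ℕ) (Z : ℕ → Matrix A A ℂ) : Prop where
  posSemidef : ∀ i, k ≤ i → i ≤ P.n → (Z i).PosSemidef
  odd_step : ∀ i, k ≤ i → i < P.n → Odd (i + 1) →
    (Z i ⊗ₖ (1 : Matrix M M ℂ) - (P.EA (i + 1) * P.UA (i + 1))ᴴ *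
      (Z (i + 1) ⊗ₖ (1 : Matrix M M ℂ)) * (P.EA (i + 1) * P.UA (i + 1))).PosDef
  even_step : ∀ i, k ≤ i → i < P.n → Even (i + 1) → Z i = Z (i + 1)
  last : Z P.n = P.FA1

variable {P : Protocol A M B}

theorem IsStrictDualA.mono {k l : ℕ} (hkl : k ≤ l) {Z : ℕ → Matrix A A ℂ}
    (h : P.IsStrictDualA k Z) : P.IsStrictDualA l Z where
  posSemidef i hi := h.posSemidef i (hkl.trans hi)
  odd_step i hi := h.odd_step i (hkl.trans hi)
  even_step i hi := h.even_step i (hkl.trans hi)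
  last := h.last

theorem IsStrictDualA.of_strictChain [Nonempty M] (hF : P.FA1.PosSemidef) {r : ℕ}
    (hr : P.n = 2 * r) {Z : ℕ → Matrix A A ℂ} (hZ : StrictChain P.opA P.FA1 r Z) :
    P.IsStrictDualA 0 fun i => Z ((i + 1) / 2) where
  posSemidef i _ hi := hZ.posSemidef hF (by lia)
  odd_step i _ hi hodd := by
    obtain ⟨j, hj⟩ := hodd
    have hstep := hZ.step j (by lia)
    rwa [show (i + 1) / 2 = j by lia, show (i + 1 + 1) / 2 = j + 1 by lia, hj]
  even_step i _ _ heven := by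
    obtain ⟨j, hj⟩ := heven
    congr 1
    lia
  last := by rw [show (P.n + 1) / 2 = r by lia, hZ.last]

theorem IsStrictDualA.of_strictChain_tail [Nonempty M] (hF : P.FA1.PosSemidef) {r : ℕ}
    (hr : P.n = 2 * (r + 1)) {Z : ℕ → Matrix A A ℂ}
    (hZ : StrictChain (fun j => P.opA (j + 1)) P.FA1 r Z) :
    P.IsStrictDualA 1 fun i => Z ((i - 1) / 2) where
  posSemidef i _ hi := hZ.posSemidef hF (by lia)
  odd_step i hi hin hodd := by
    obtain ⟨j, hj⟩ := hodd
    obtain ⟨j, rfl⟩ := Nat.exists_eq_add_one_of_ne_zero (show j ≠ 0 by lia)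
    have hstep := hZ.step j (by lia)
    rwa [show (i - 1) / 2 = j by lia, show (i + 1 - 1) / 2 = j + 1 by lia, hj]
  even_step i _ _ heven := by
    obtain ⟨j, hj⟩ := heven
    congr 1
    lia
  last := by rw [show (P.n - 1) / 2 = r by lia, hZ.last]

end Alice

section Bob

variable [Fintype B]

/-- A dual feasible point `Z_0, …, Z_n` bounding Alice's cheating, without its eigenvalue condition,
whose inequalities are strict. -/
structure IsStrictDualB (P : Protocol A M B) (Z : ℕ → Matrix B B ℂ) : Prop where
  posSemidef : ∀ i ≤ P.n, (Z i).PosSemidef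
  even_step : ∀ i < P.n, Even (i + 1) →
    ((1 : Matrix M M ℂ) ⊗ₖ Z i - (P.EB (i + 1) * P.UB (i + 1))ᴴ *
      ((1 : Matrix M M ℂ) ⊗ₖ Z (i + 1)) * (P.EB (i + 1) * P.UB (i + 1))).PosDef
  odd_step : ∀ i < P.n, Odd (i + 1) → Z i = Z (i + 1)
  last : Z P.n = P.FB0

theorem IsStrictDualB.of_strictChain [Nonempty M] {P : Protocol A M B} (hF : P.FB0.PosSemidef)
    {r : ℕ} (hr : P.n = 2 * r) {Z : ℕ → Matrix B B ℂ} (hZ : StrictChain P.opB P.FB0 r Z) :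
    P.IsStrictDualB fun i => Z (i / 2) where
  posSemidef i hi := hZ.posSemidef hF (by lia)
  even_step i hi heven := by
    obtain ⟨j, hj⟩ := heven
    obtain ⟨j, rfl⟩ := Nat.exists_eq_add_one_of_ne_zero (show j ≠ 0 by lia)
    have hstep := posDef_one_kronecker_sub_of_swap (hZ.step j (by lia))
    rwa [show i / 2 = j by lia, show (i + 1) / 2 = j + 1 by lia, show i + 1 = 2 * j + 2 by lia]
  odd_step i _ hodd := by
    obtain ⟨j, hj⟩ := hodd
    congr 1
    lia
  last := by rw [show P.n / 2 = r by lia, hZ.last]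

end Bob

variable [Fintype A] [DecidableEq A] [Fintype B] [DecidableEq B] {P : Protocol A M B}
variable (hP : P.IsWCF)

include hP

theorem IsWCF.isDualFeasibleA {Z : ℕ → Matrix A A ℂ} (hZ : P.IsStrictDualA 0 Z) {β : ℝ}
    (hβ : 0 < β) (hβψ : Z 0 *ᵥ P.ψA = (β : ℂ) • P.ψA) : P.IsDualFeasibleA Z β where
  posSemidef i := hZ.posSemidef i i.zero_le
  odd_step i hodd hi := by
    obtain ⟨i, rfl⟩ := Nat.exists_eq_add_one_of_ne_zero hodd.pos.ne'
    have hE : (P.EA (i + 1))ᴴ = P.EA (i + 1) := (hP.proj_EA _ hodd hi).isSelfAdjoint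
    have hstep := (hZ.odd_step i i.zero_le hi hodd).posSemidef
    rw [Matrix.conjTranspose_mul, hE] at hstep
    simpa only [Nat.add_sub_cancel, Matrix.mul_assoc] using hstep
  even_step i heven hi hin := by
    obtain ⟨i, rfl⟩ := Nat.exists_eq_add_one_of_ne_zero hi.ne'
    exact hZ.even_step i i.zero_le hin heven
  last := hZ.last
  pos := hβ
  eigen := hβψ

theorem IsWCF.isDualFeasibleB {Z : ℕ → Matrix B B ℂ} (hZ : P.IsStrictDualB Z) {α : ℝ}
    (hα : 0 < α) (hαψ : Z 0 *ᵥ P.ψB = (α : ℂ) • P.ψB) : P.IsDualFeasibleB Z α where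
  posSemidef := hZ.posSemidef
  even_step i heven hi hin := by
    obtain ⟨i, rfl⟩ := Nat.exists_eq_add_one_of_ne_zero hi.ne'
    have hE : (P.EB (i + 1))ᴴ = P.EB (i + 1) := (hP.proj_EB _ heven hi hin).isSelfAdjoint
    have hstep := (hZ.even_step i hin heven).posSemidef
    rw [Matrix.conjTranspose_mul, hE] at hstep
    simpa only [Nat.add_sub_cancel, Matrix.mul_assoc] using hstep
  odd_step i hodd hin := by
    obtain ⟨i, rfl⟩ := Nat.exists_eq_add_one_of_ne_zero hodd.pos.ne'
    exact hZ.odd_step i hin hodd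
  last := hZ.last
  pos := hα
  eigen := hαψ

theorem IsWCF.exists_eq_two_mul_succ : ∃ r, P.n = 2 * (r + 1) := by
  obtain ⟨s, hs⟩ := hP.even_n
  have := hP.n_ne_zero
  exact ⟨s - 1, by lia⟩

theorem IsWCF.exists_isStrictDualA_of_optBEarly_lt {β : ℝ} (hβ : P.optBEarly < β) :
    ∃ Z, P.IsStrictDualA 0 Z ∧ Z 0 *ᵥ P.ψA = (β : ℂ) • P.ψA := by
  have := nonempty_of_sqNorm_eq_one hP.unit_ψM
  obtain ⟨r, hr⟩ := hP.exists_eq_two_mul_succ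
  obtain ⟨Z, hZ, hZψ⟩ := hP.exists_strictChain_of_optBEarly_lt hr hβ
  exact ⟨_, .of_strictChain hP.posSemidef_FA1 hr hZ, hZψ⟩

theorem IsWCF.exists_isStrictDualA_of_optB_lt {β : ℝ} (hβ : P.optB < β) :
    ∃ Z, P.IsStrictDualA 1 Z ∧ (braket (P.honest 1) (onAB (Z 1) 1 *ᵥ P.honest 1)).re < β := by
  have := nonempty_of_sqNorm_eq_one hP.unit_ψM
  obtain ⟨r, hr⟩ := hP.exists_eq_two_mul_succ
  obtain ⟨Z, hZ, hZβ⟩ := hP.exists_strictChain_of_optB_lt hr hβ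
  exact ⟨_, .of_strictChain_tail hP.posSemidef_FA1 hr hZ, hZβ⟩

theorem IsWCF.exists_isStrictDualB_of_optA_lt {α : ℝ} (hα : P.optA < α) :
    ∃ Z, P.IsStrictDualB Z ∧ Z 0 *ᵥ P.ψB = (α : ℂ) • P.ψB := by
  have := nonempty_of_sqNorm_eq_one hP.unit_ψM
  obtain ⟨r, hr⟩ := hP.exists_eq_two_mul_succ
  obtain ⟨Z, hZ, hZψ⟩ := hP.exists_strictChain_of_optA_lt hr hα
  exact ⟨_, .of_strictChain hP.posSemidef_FB0 hr hZ, hZψ⟩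

end Protocol

end StrictDual

section Game

variable {A M B : Type*} [Fintype A] [DecidableEq A] [Fintype M] [DecidableEq M]
  [Fintype B] [DecidableEq B]

theorem point_nonneg (β α : ℝ≥0) (z : ℝ≥0 × ℝ≥0) : 0 ≤ point β α z := by
  rw [point]
  split_ifs <;> norm_num

theorem finite_support_point (β α : ℝ≥0) : (Function.support (point β α)).Finite :=
  (Set.finite_singleton (β, α)).subset fun _ hz => by_contra fun hne => hz (if_neg hne)

namespace Protocol

/-- The functions `prob[Z_A, Z_B, ψ]` along the honest run, read backwards: the game starts from the
final state of the protocol. -/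
noncomputable def dualGame (P : Protocol A M B) (ZA : ℕ → Matrix A A ℂ) (ZB : ℕ → Matrix B B ℂ)
    (i : ℕ) : ℝ≥0 × ℝ≥0 → ℝ :=
  prob₂ (ZA (P.n - i)) (ZB (P.n - i)) (P.honest (P.n - i))

variable {P : Protocol A M B} (hP : P.IsWCF) {ZA : ℕ → Matrix A A ℂ} {ZB : ℕ → Matrix B B ℂ}

include hP

theorem IsWCF.ebmVertical_dualGame (hA : P.IsStrictDualA 1 ZA) (hB : P.IsStrictDualB ZB) {i : ℕ}
    (hi : i < P.n) (heven : Even i) :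
    EBMVertical (P.dualGame ZA ZB i) (P.dualGame ZA ZB (i + 1)) := by
  have hround : Even (P.n - i) := (Nat.even_sub hi.le).2 (iff_of_true hP.even_n heven)
  obtain ⟨k, hk⟩ := Nat.exists_eq_add_one_of_ne_zero (Nat.sub_ne_zero_of_lt hi)
  have hk' : P.n - (i + 1) = k := by lia
  rw [hk] at hround
  have hk1 : 1 ≤ k := by
    obtain ⟨j, hj⟩ := hround
    lia
  rw [dualGame, dualGame, hk, hk', hA.even_step k hk1 (by lia) hround]
  exact hP.ebmVertical hround (by lia) _ (hB.posSemidef _ (by lia))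
    (hB.even_step k (by lia) hround)

theorem IsWCF.ebmHorizontal_dualGame {l : ℕ} (hA : P.IsStrictDualA l ZA) (hB : P.IsStrictDualB ZB)
    {i : ℕ} (hi : i + l < P.n) (hodd : Odd i) :
    EBMHorizontal (P.dualGame ZA ZB i) (P.dualGame ZA ZB (i + 1)) := by
  have hround : Odd (P.n - i) := Nat.Even.sub_odd (by lia) hP.even_n hodd
  obtain ⟨k, hk⟩ := Nat.exists_eq_add_one_of_ne_zero hround.pos.ne'
  have hk' : P.n - (i + 1) = k := by lia
  rw [hk] at hround
  rw [dualGame, dualGame, hk, hk', hB.odd_step k (by lia) hround]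
  exact hP.ebmHorizontal hround (by lia) _ (hA.posSemidef _ (by lia) (by lia))
    (hA.odd_step k (by lia) (by lia) hround)

theorem IsWCF.isEBMPointGame_update_dualGame (hA : P.IsStrictDualA 1 ZA) (hB : P.IsStrictDualB ZB)
    {β α : ℝ≥0} (hfinal : EBMHorizontal (prob₂ (ZA 1) (ZB 1) (P.honest 1)) (point β α)) :
    IsEBMPointGame P.n (Function.update (P.dualGame ZA ZB) P.n (point β α)) β α where
  nonneg i _ := by
    rcases eq_or_ne i P.n with rfl | hi
    · simpa only [Function.update_self] using point_nonneg β α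
    · simpa only [Function.update_of_ne hi, dualGame] using prob₂_nonneg _ _ _
  finite_support i _ := by
    rcases eq_or_ne i P.n with rfl | hi
    · simpa only [Function.update_self] using finite_support_point β α
    · simpa only [Function.update_of_ne hi, dualGame] using finite_support_prob₂ _ _ _
  init := by
    rw [Function.update_of_ne hP.n_ne_zero.symm, dualGame, Nat.sub_zero, hA.last, hB.last,
      hP.prob₂_init]
  vertical i hi heven := by
    have hi' : i + 1 ≠ P.n := fun h => Nat.not_even_iff_odd.2 heven.add_one (h ▸ hP.even_n)
    rw [Function.update_of_ne hi.ne, Function.update_of_ne hi']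
    exact hP.ebmVertical_dualGame hA hB hi heven
  horizontal i hi hodd := by
    rw [Function.update_of_ne hi.ne]
    rcases eq_or_ne (i + 1) P.n with hi' | hi'
    · rw [hi', Function.update_self, dualGame, show P.n - i = 1 by lia]
      exact hfinal
    · rw [Function.update_of_ne hi']
      exact hP.ebmHorizontal_dualGame hA hB (lt_of_le_of_ne hi hi') hodd
  final := Function.update_self _ _ _

theorem IsWCF.exists_isEBMPointGame {β α : ℝ≥0} (hβ : P.optB < β) (hα : P.optA < α) :
    ∃ p, IsEBMPointGame P.n p β α := by
  obtain ⟨ZA, hA, hAβ⟩ := hP.exists_isStrictDualA_of_optB_lt hβ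
  obtain ⟨ZB, hB, hBα⟩ := hP.exists_isStrictDualB_of_optA_lt hα
  have hn : 0 < P.n := Nat.pos_of_ne_zero hP.n_ne_zero
  rw [hB.odd_step 0 hn odd_one] at hBα
  exact ⟨_, hP.isEBMPointGame_update_dualGame hA hB (hP.ebmHorizontal_honest_one_point
    (hA.posSemidef 1 le_rfl hn) (hB.posSemidef 1 hn).isHermitian hAβ hBα)⟩

theorem IsWCF.isEBMPointGame_dualGame (hA : P.IsStrictDualA 0 ZA) (hB : P.IsStrictDualB ZB)
    {β α : ℝ≥0} (hβ : ZA 0 *ᵥ P.ψA = ((β : ℝ) : ℂ) • P.ψA)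
    (hα : ZB 0 *ᵥ P.ψB = ((α : ℝ) : ℂ) • P.ψB) : IsEBMPointGame P.n (P.dualGame ZA ZB) β α := by
  have hn : 0 < P.n := Nat.pos_of_ne_zero hP.n_ne_zero
  have hlast : prob₂ (ZA 0) (ZB 0) (P.honest 0) = point β α :=
    hP.prob₂_final (hA.posSemidef 0 le_rfl hn.le).isHermitian (hB.posSemidef 0 hn.le).isHermitian
      hβ hα
  have hstep : EBMHorizontal (prob₂ (ZA 1) (ZB 1) (P.honest 1)) (point β α) := by
    rw [← hlast, hB.odd_step 0 hn odd_one]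
    exact hP.ebmHorizontal odd_one hn _ (hA.posSemidef 1 zero_le_one hn)
      (hA.odd_step 0 le_rfl hn odd_one)
  have hgame := hP.isEBMPointGame_update_dualGame (hA.mono zero_le_one) hB hstep
  rwa [Function.update_eq_self_iff.2] at hgame
  rw [dualGame, Nat.sub_self, hlast]

end Protocol

end Game

end CoinFlip

theorem mainTheorem10 {A M B : Type*} [Fintype A] [DecidableEq A] [Fintype M] [DecidableEq M]
    [Fintype B] [DecidableEq B] (P : CoinFlip.Protocol A M B) (hP : P.IsWCF)
    (δ : ℝ) (hδ : 0 < δ) :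
    (∃ β α : ℝ≥0, (β : ℝ) = P.optB + δ ∧ (α : ℝ) = P.optA + δ ∧
      ∃ (m : ℕ) (p : ℕ → ℝ≥0 × ℝ≥0 → ℝ), CoinFlip.IsEBMPointGame m p β α) ∧
    (∃ β α : ℝ≥0, (β : ℝ) = P.optBEarly + δ ∧ (α : ℝ) = P.optA + δ ∧
      ∃ (ZA : ℕ → Matrix A A ℂ) (ZB : ℕ → Matrix B B ℂ),
        P.IsDualFeasibleA ZA β ∧ P.IsDualFeasibleB ZB α ∧
        CoinFlip.IsEBMPointGame P.n
          (fun i => CoinFlip.prob₂ (ZA (P.n - i)) (ZB (P.n - i)) (P.honest (P.n - i))) β α) := by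
  have hB₀ := hP.optB_nonneg
  have hE₀ := hP.optBEarly_nonneg
  have hA₀ := hP.optA_nonneg
  let α : ℝ≥0 := ⟨P.optA + δ, by positivity⟩
  have hα : P.optA < α := lt_add_of_pos_right _ hδ
  constructor
  · let β : ℝ≥0 := ⟨P.optB + δ, by positivity⟩
    have hβ : P.optB < β := lt_add_of_pos_right _ hδ
    obtain ⟨p, hp⟩ := hP.exists_isEBMPointGame hβ hα
    exact ⟨β, α, rfl, rfl, P.n, p, hp⟩
  · let β : ℝ≥0 := ⟨P.optBEarly + δ, by positivity⟩
    have hβ : P.optBEarly < β := lt_add_of_pos_right _ hδ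
    obtain ⟨ZA, hZA, hβψ⟩ := hP.exists_isStrictDualA_of_optBEarly_lt hβ
    obtain ⟨ZB, hZB, hαψ⟩ := hP.exists_isStrictDualB_of_optA_lt hα
    exact ⟨β, α, rfl, rfl, ZA, ZB, hP.isDualFeasibleA hZA (hE₀.trans_lt hβ) hβψ,
      hP.isDualFeasibleB hZB (hA₀.trans_lt hα) hαψ, hP.isEBMPointGame_dualGame hZA hZB hβψ hαψ⟩
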